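/- All graphs are finite and simple. For a graph $G$ and $X\subseteq V(G)$, $\chi(X)$ is the chromatic number of the induced subgraph $G[X]$, and $\chi^{\rho}(G)$ is the maximum over $v\in V(G)$ of $\chi(N^{\rho}_G[v])$, where $N^\rho_G[v]$ is the set of vertices at distance at most $\rho$ from $v$ (zero for the null graph). The $G$-distance between two sets of vertices is the minimum distance in $G$ between a member of one and a member of the other ($\infty$ if there is no path between them). $K_\nu^1$ is the graph obtained from the complete graph $K_\nu$ by subdividing every edge once. A subdivision of $H$ is a graph obtained from $H$ by replacing each edge $uv$ by a path of length at least one joining $u,v$, these paths being vertex-disjoint except for their ends; $G$ is $H$-subdivision-free if no induced subgraph of $G$ is a subdivision of $H$. A rooted tree $(T,r)$ is a tree $T$ with a vertex $r$. A vertex $v$ is an ancestor of $u$, and $u$ a descendant of $v$, if $v$ lies on the path of $T$ between $u$ and $r$ (so each vertex is an ancestor of itself); $u,v$ are incomparable if neither is a descendant of the other; $L(T)$ is the set of vertices with no children. For $X,Y\subseteq V(G)$, $Y$ covers $X$ if $X\cap Y=\emptyset$ and every vertex of $X$ has a neighbour in $Y$. The pair $(X,Y)$ is a pineapple if $Y$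 covers $X$ and $G[Y]$ is connected (in particular $Y\ne\emptyset$). It is levelled if there are $z_0\in Y$ and an integer $k$ such that every vertex of $Y$ is joined to $z_0$ by a path of $G[Y]$ of length less than $k$, and there is no path of $G[X\cup Y]$ of length less than $k$ from $z_0$ to $X$. A pineapple tree in $G$ of shape $(T,r)$ consists of a levelled pineapple $(X_v,Y_v)$ in $G$ for each $v\in V(T)\setminus L(T)$ and a set $C_v\subseteq V(G)$ for each $v\in L(T)$ such that, writing $C_v=X_v\cup Y_v$ for $v\in V(T)\setminus L(T)$: - the sets $C_v$ $(v\in V(T))$ are nonempty and pairwise disjoint; - for all incomparable $u,v\in V(T)$ there is no edge between $C_u$ and $C_v$; - if $u,v\in V(T)$ are distinct and $u$ is a descendant of $v$, then there is no edge between $C_u$ and $Y_v$, and if also $u\in L(T)$ then $X_v$ covers $C_u$. Its vertex set is $\bigcup_{v\in V(T)}C_v$. It is fruitful if for all distinct $u,v,w\in V(T)$ such that $u\in L(T)$, $w$ is an ancestor of $u$ and $v$ is an ancestor of $w$, every vertex of $X_v$ with a neighbour in $C_u$ has a neighbour in $Y_w$. **Theorem.** For all integers $\nu,c,d,\tau\ge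 0$ and every rooted tree $(T,r)$ there exists $c'$ with the following property. Let $G$ be a $K_\nu^1$-subdivision-free graph with $\chi^{2d+7}(G)\le\tau$, and let $Z\subseteq V(G)$ with $\chi(Z)>c'$. Then there is a fruitful pineapple tree in $G$ of shape $(T,r)$, with vertex set a subset of $Z$, such that $\chi(C_v)>c$ for each $v\in L(T)$, and for all incomparable $u,v\in L(T)$ the $G$-distance between $C_u$ and $C_v$ is at least $d+1$. -/

import Mathlib

namespace InducedSubgraphs

/-! ### Chromatic number of subsets and balls, distance between sets -/

section Graphs

variable {V : Type*}

/-- `χ(X)`, the chromatic number of the subgraph induced on `X`. -/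
noncomputable def chi (G : SimpleGraph V) (X : Set V) : ℕ∞ :=
  (G.induce X).chromaticNumber

/-- `N^ρ[v]`, the set of vertices at distance at most `ρ` from `v`. -/
def ball (G : SimpleGraph V) (ρ : ℕ) (v : V) : Set V :=
  {u | G.edist v u ≤ (ρ : ℕ∞)}

/-- `χ^ρ(G)`, the maximum over all vertices `v` of `χ(N^ρ[v])`, and zero for the null graph. -/
noncomputable def chiBall (G : SimpleGraph V) (ρ : ℕ) : ℕ∞ :=
  ⨆ v : V, chi G (ball G ρ v)

/-- The distance in `G` between two sets of vertices (infinite if no path joins them). -/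
noncomputable def setDist (G : SimpleGraph V) (A B : Set V) : ℕ∞ :=
  ⨅ a ∈ A, ⨅ b ∈ B, G.edist a b

end Graphs

/-! ### Subdivisions -/

/-- The data showing that `J` is a subdivision of `H`: `J` is obtained from `H` by replacing each
edge by a path joining its ends, these paths being vertex-disjoint except for their ends. The paths
are indexed by the oriented edges of `H`, the two orientations of an edge giving the same path; they
have length at least one, as `branch` is injective. -/
structure Subdivision {V W : Type*} (J : SimpleGraph W) (H : SimpleGraph V) where
  /-- the vertices of `H` inside `J` -/
  branch : V ↪ W
  /-- the path that replaces an edge -/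
  path : ∀ e : H.Dart, J.Walk (branch e.fst) (branch e.snd)
  isPath : ∀ e, (path e).IsPath
  path_symm : ∀ e, path e.symm = (path e).reverse
  disjoint : ∀ e f : H.Dart, e.edge ≠ f.edge → ∀ x,
    x ∈ (path e).support → x ∈ (path f).support →
      (x = branch e.fst ∨ x = branch e.snd) ∧ (x = branch f.fst ∨ x = branch f.snd)
  branch_mem : ∀ (e : H.Dart) (v : V), branch v ∈ (path e).support → v = e.fst ∨ v = e.snd
  vertex_mem : ∀ x : W, (∃ v, branch v = x) ∨ ∃ e, x ∈ (path e).support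
  edge_mem : ∀ a ∈ J.edgeSet, ∃ e, a ∈ (path e).edges

/-- `G` is `H`-subdivision-free: no induced subgraph of `G` is a subdivision of `H`. -/
def SubdivisionFree {V W : Type*} (H : SimpleGraph W) (G : SimpleGraph V) : Prop :=
  ∀ S : Set V, IsEmpty (Subdivision (G.induce S) H)

/-- The graph obtained from `H` by subdividing every edge once. -/
def oneSubdivision {V : Type*} (H : SimpleGraph V) : SimpleGraph (V ⊕ H.edgeSet) :=
  SimpleGraph.fromRel fun a b => ∃ (v : V) (e : H.edgeSet), a = Sum.inl v ∧ b = Sum.inr e ∧ v ∈ e.1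

/-- `K_ν^1`, the complete graph `K_ν` with every edge subdivided once. -/
def subdividedComplete (ν : ℕ) :
    SimpleGraph (Fin ν ⊕ (⊤ : SimpleGraph (Fin ν)).edgeSet) :=
  oneSubdivision ⊤

/-! ### Rooted trees -/

section Trees

variable {I : Type*}

/-- In the tree `T` with root `r`, the vertex `v` is an ancestor of `u` (and `u` is a descendant
of `v`): it belongs to the path of `T` between `u` and `r`. Each vertex is its own ancestor. -/
def IsAncestor (T : SimpleGraph I) (r v u : I) : Prop :=
  ∃ p : T.Walk u r, p.IsPath ∧ v ∈ p.support

/-- `u` is a child of `v`. -/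
def IsChild (T : SimpleGraph I) (r u v : I) : Prop :=
  T.Adj u v ∧ IsAncestor T r v u

/-- `v ∈ L(T)`: the vertex `v` has no children. -/
def IsLeaf (T : SimpleGraph I) (r v : I) : Prop :=
  ∀ u, ¬ IsChild T r u v

/-- Neither of `u`, `v` is a descendant of the other. -/
def Incomparable (T : SimpleGraph I) (r u v : I) : Prop :=
  ¬ IsAncestor T r u v ∧ ¬ IsAncestor T r v u

/-- `(u, v, w)` is an aligned triple: `u` is a leaf, `w` is an ancestor of `u`, `v` is an ancestor
of `w`, and the three are different. -/
def AlignedTriple (T : SimpleGraph I) (r u v w : I) : Prop :=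
  IsLeaf T r u ∧ IsAncestor T r w u ∧ IsAncestor T r v w ∧ u ≠ v ∧ u ≠ w ∧ v ≠ w

end Trees

/-! ### Pineapples and pineapple trees -/

section Pineapples

variable {V : Type*}

/-- There is no edge between `A` and `B`. -/
def NoEdges (G : SimpleGraph V) (A B : Set V) : Prop :=
  ∀ a ∈ A, ∀ b ∈ B, ¬ G.Adj a b

/-- `Y` covers `X`. -/
def Covers (G : SimpleGraph V) (Y X : Set V) : Prop :=
  Disjoint X Y ∧ ∀ x ∈ X, ∃ y ∈ Y, G.Adj x y

/-- `(X, Y)` is a pineapple in `G`. -/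
def IsPineapple (G : SimpleGraph V) (X Y : Set V) : Prop :=
  Covers G Y X ∧ (G.induce Y).Connected

/-- `(X, Y)` is a levelled pineapple in `G`. A path of the subgraph induced on a set is written as
a path of `G` with all its vertices in that set. -/
def IsLevelledPineapple (G : SimpleGraph V) (X Y : Set V) : Prop :=
  IsPineapple G X Y ∧ ∃ z ∈ Y, ∃ k : ℕ,
    (∀ y ∈ Y, ∃ p : G.Walk y z, p.IsPath ∧ (∀ w ∈ p.support, w ∈ Y) ∧ p.length < k) ∧
    ∀ x ∈ X, ¬ ∃ p : G.Walk z x, p.IsPath ∧ (∀ w ∈ p.support, w ∈ X ∪ Y) ∧ p.length < k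

/-- A pineapple tree in `G` of shape `(T, r)`. The values of `X` and `Y` at the leaves of `T` play
no role. -/
structure PineappleTree {I : Type*} (G : SimpleGraph V) (T : SimpleGraph I) (r : I) where
  X : I → Set V
  Y : I → Set V
  C : I → Set V
  levelled : ∀ v, ¬ IsLeaf T r v → IsLevelledPineapple G (X v) (Y v)
  C_eq : ∀ v, ¬ IsLeaf T r v → C v = X v ∪ Y v
  nonempty : ∀ v, (C v).Nonempty
  disjoint : ∀ u v, u ≠ v → Disjoint (C u) (C v)
  incomparable : ∀ u v, Incomparable T r u v → NoEdges G (C u) (C v)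
  descendant : ∀ u v, u ≠ v → IsAncestor T r v u → NoEdges G (C u) (Y v)
  covers : ∀ u v, u ≠ v → IsAncestor T r v u → IsLeaf T r u → Covers G (X v) (C u)

namespace PineappleTree

variable {I : Type*} {G : SimpleGraph V} {T : SimpleGraph I} {r : I}

/-- The vertex set of a pineapple tree. -/
def vertexSet (P : PineappleTree G T r) : Set V :=
  ⋃ v, P.C v

/-- `X_v^u`, the set of vertices in `X_v` with a neighbour in `C_u`. -/
def attach (P : PineappleTree G T r) (v u : I) : Set V :=
  {x | x ∈ P.X v ∧ ∃ c ∈ P.C u, G.Adj x c}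

/-- For every aligned triple `(u, v, w)`, every member of `X_v^u` has a neighbour in `Y_w`. -/
def Fruitful (P : PineappleTree G T r) : Prop :=
  ∀ u v w, AlignedTriple T r u v w → ∀ x ∈ P.attach v u, ∃ y ∈ P.Y w, G.Adj x y

end PineappleTree

end Pineapples

end InducedSubgraphs

/-! The theorem rests on a splitting principle and a Ramsey argument, both exploiting one
obstruction (`not_subdivisionFree_of_grid`): `ν` vertices far apart, each joined by the legs of an
induced spider to the same family of pairwise anticomplete connected sets, one set for each pair of
vertices, yield an induced subdivision of `K_ν^1`.

Splitting (`exists_split`): a set of huge chromatic number contains two subsets of large chromatic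
number at distance more than `D`. If not, grow a connected set until the chromatic number of its
second neighbourhood just exceeds the bound. Almost all of `Z` is then near that neighbourhood, so
some level at a bounded distance `k ≥ 3` from the connected set still has large chromatic number.
Repeating inside this level gives many connected sets, pairwise far apart and all at one common
distance from every vertex of a set of large chromatic number. By `exists_spider`, the geodesics
from each such vertex to the connected sets contain a large induced spider, and the obstruction
appears.

Building: a breadth-first search in `Z` gives a levelled pineapple covering a set of large chromatic
number (`exists_levelledPineapple`). Alternating this with splitting produces complete trees of
nested pineapples of any depth and branching (`exists_hasSystem`).

Fruitfulness: let each vertex `u` of a leaf region choose one neighbour in the `X`-part of every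
pineapple above it. By Ramsey, a long branch contains either many pineapples that are pairwise
`Good` for `u`, or many that are pairwise `Bad`. The positions used are made the same for all `u`
and all leaves by regarding them as a colour. The bad case is the obstruction again, with stars as
spiders (`not_subdivisionFree_of_bad`); in the good case the unused levels are forgotten
(`HasSystem.thin`). Finally `(T, r)` is embedded in the resulting system, and each `X` is cut down
to the chosen neighbours (`IsSystem.exists_pineappleTree`). -/

namespace InducedSubgraphs

open SimpleGraph

/-! ### Chromatic number through colourings by natural numbers. -/

section Colouring

variable {V : Type*} {G : SimpleGraph V}

/-- The subgraph induced on `X` has a proper colouring with `n` colours. -/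
def ColorableOn (G : SimpleGraph V) (X : Set V) (n : ℕ) : Prop :=
  ∃ f : V → ℕ, (∀ v ∈ X, f v < n) ∧ ∀ u ∈ X, ∀ v ∈ X, G.Adj u v → f u ≠ f v

/-- Colourings become total functions on `V`, so that unions and restrictions of sets need no
subtypes. -/
theorem chi_le_iff {X : Set V} {n : ℕ} : chi G X ≤ n ↔ ColorableOn G X n := by
  classical
  unfold chi
  rw [chromaticNumber_le_iff_colorable]
  constructor
  · rintro ⟨c⟩
    refine ⟨fun v => if h : v ∈ X then (c ⟨v, h⟩ : ℕ) else 0, ?_, ?_⟩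
    · intro v hv
      simp [hv]
    · intro u hu v hv huv
      have : c ⟨u, hu⟩ ≠ c ⟨v, hv⟩ := c.valid huv
      simp only [hu, hv, dif_pos]
      exact fun h => this (Fin.ext h)
  · rintro ⟨f, hf, hp⟩
    exact ⟨Coloring.mk (fun v => (⟨f v, hf v v.2⟩ : Fin n))
      fun {u v} huv h => hp u u.2 v v.2 huv (congrArg Fin.val h)⟩

theorem lt_chi_iff {X : Set V} {n : ℕ} : (n : ℕ∞) < chi G X ↔ ¬ ColorableOn G X n := by
  rw [← chi_le_iff, not_le]

theorem ColorableOn.mono {X Y : Set V} {m n : ℕ} (h : ColorableOn G Y m) (hXY : X ⊆ Y)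
    (hmn : m ≤ n) : ColorableOn G X n := by
  obtain ⟨f, hf, hp⟩ := h
  exact ⟨f, fun v hv => (hf v (hXY hv)).trans_le hmn,
    fun u hu v hv => hp u (hXY hu) v (hXY hv)⟩

theorem ColorableOn.union {X Y : Set V} {m n : ℕ} (hX : ColorableOn G X m)
    (hY : ColorableOn G Y n) : ColorableOn G (X ∪ Y) (m + n) := by
  classical
  obtain ⟨f, hf, hp⟩ := hX
  obtain ⟨g, hg, hq⟩ := hY
  refine ⟨fun v => if v ∈ X then f v else m + g v, ?_, ?_⟩
  · intro v hv
    by_cases h : v ∈ X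
    · simp only [h, if_true]
      have := hf v h
      omega
    · simp only [h, if_false]
      have := hg v (hv.resolve_left h)
      omega
  · intro u hu v hv huv
    by_cases h : u ∈ X <;> by_cases h' : v ∈ X <;> simp only [h, h', if_true, if_false]
    · exact hp u h v h' huv
    · have := hf u h
      omega
    · have := hf v h'
      omega
    · have := hq u (hu.resolve_left h) v (hv.resolve_left h') huv
      omega

theorem colorableOn_empty (n : ℕ) : ColorableOn G ∅ n := ⟨fun _ => 0, by simp, by simp⟩

theorem nonempty_of_not_colorableOn {X : Set V} {n : ℕ} (h : ¬ ColorableOn G X n) :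
    X.Nonempty := by
  by_contra hX
  rw [Set.not_nonempty_iff_eq_empty] at hX
  exact h (hX ▸ colorableOn_empty n)

theorem colorableOn_singleton (v : V) : ColorableOn G {v} 1 :=
  ⟨fun _ => 0, by simp, by
    rintro u hu w hw h
    rw [Set.mem_singleton_iff] at hu hw
    subst hu; subst hw
    exact absurd h (G.loopless.irrefl _)⟩

theorem colorableOn_biUnion {ι : Type*} (s : Finset ι) (X : ι → Set V) (n : ℕ)
    (h : ∀ i ∈ s, ColorableOn G (X i) n) : ColorableOn G (⋃ i ∈ s, X i) (s.card * n) := by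
  classical
  induction s using Finset.induction_on with
  | empty => simpa using colorableOn_empty 0
  | insert a s ha ih =>
    rw [Finset.set_biUnion_insert, Finset.card_insert_of_notMem ha]
    have := (h a (Finset.mem_insert_self _ _)).union
      (ih fun i hi => h i (Finset.mem_insert_of_mem hi))
    exact this.mono subset_rfl (by linarith)

/-- Partition of a set of large chromatic number into boundedly many classes. -/
theorem exists_fiber_not_colorableOn {K : Type*} [Fintype K] (κ : V → K) {X : Set V} {n : ℕ}
    (h : ¬ ColorableOn G X (Fintype.card K * n)) :
    ∃ k, ¬ ColorableOn G {v ∈ X | κ v = k} n := by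
  by_contra! hk
  refine h ((colorableOn_biUnion Finset.univ _ n fun k _ => hk k).mono ?_ le_rfl)
  intro v hv
  simp [hv]

end Colouring

/-! ### Connectivity and distance levels inside a set. -/

section Restrict

variable {V : Type*} {G : SimpleGraph V}

/-- The spanning subgraph whose edges are the edges with both ends in `W`. -/
def restrict (G : SimpleGraph V) (W : Set V) : SimpleGraph V where
  Adj u v := G.Adj u v ∧ u ∈ W ∧ v ∈ W
  symm := ⟨fun _ _ h => ⟨h.1.symm, h.2.2, h.2.1⟩⟩
  loopless := ⟨fun _ h => G.loopless.irrefl _ h.1⟩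

theorem restrict_le (W : Set V) : restrict G W ≤ G := fun _ _ h => h.1

theorem restrict_mono {W W' : Set V} (h : W ⊆ W') : restrict G W ≤ restrict G W' :=
  fun _ _ e => ⟨e.1, h e.2.1, h e.2.2⟩

theorem support_subset_of_restrict {W : Set V} {a b : V} (p : (restrict G W).Walk a b)
    (ha : a ∈ W) : ∀ x ∈ p.support, x ∈ W := by
  induction p with
  | nil => simpa using ha
  | cons h p ih =>
    intro x hx
    rw [Walk.support_cons, List.mem_cons] at hx
    rcases hx with rfl | hx
    · exact ha
    · exact ih h.2.2 x hx

theorem mem_of_restrict_reachable {W : Set V} {a b : V} (h : (restrict G W).Reachable a b)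
    (ha : a ∈ W) : b ∈ W := by
  obtain ⟨p⟩ := h
  exact support_subset_of_restrict p ha b p.end_mem_support

/-- A walk inside `W` is a walk of `restrict G W`. -/
theorem exists_restrict_walk {W : Set V} {a b : V} (p : G.Walk a b) (h : ∀ x ∈ p.support, x ∈ W) :
    ∃ q : (restrict G W).Walk a b, q.length = p.length := by
  induction p with
  | nil => exact ⟨Walk.nil, rfl⟩
  | cons e p ih =>
    obtain ⟨q, hq⟩ := ih fun x hx => h x (by simp [hx])
    have e' : (restrict G W).Adj _ _ := ⟨e, h _ (by simp), h _ (by simp)⟩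
    exact ⟨Walk.cons e' q, by simp [hq]⟩

/-- Every two vertices of `Y` are joined inside `Y`. -/
def ConnOn (G : SimpleGraph V) (Y : Set V) : Prop :=
  ∀ a ∈ Y, ∀ b ∈ Y, (restrict G Y).Reachable a b

theorem ConnOn.induce_connected {Y : Set V} (h : ConnOn G Y) (hne : Y.Nonempty) :
    (G.induce Y).Connected := by
  have : Nonempty Y := hne.to_subtype
  refine ⟨?_⟩
  rintro ⟨a, ha⟩ ⟨b, hb⟩
  obtain ⟨p⟩ := h a ha b hb
  have hp : ∀ x ∈ (p.mapLe (restrict_le Y)).support, x ∈ Y := by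
    intro x hx
    rw [Walk.support_mapLe_eq_support] at hx
    exact support_subset_of_restrict p ha x hx
  exact ⟨(p.mapLe (restrict_le Y)).induce Y hp⟩

theorem connOn_of_induce_connected {Y : Set V} (h : (G.induce Y).Connected) : ConnOn G Y := by
  intro a ha b hb
  obtain ⟨p⟩ := h.preconnected ⟨a, ha⟩ ⟨b, hb⟩
  obtain ⟨q, -⟩ := exists_restrict_walk (W := Y) (p.map (Embedding.induce Y).toHom) (by
    intro x hx
    rw [Walk.support_map, List.mem_map] at hx
    obtain ⟨y, -, rfl⟩ := hx
    exact y.2)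
  exact ⟨q⟩

theorem connOn_singleton (v : V) : ConnOn G {v} := by
  rintro a rfl b rfl
  exact Reachable.rfl

theorem connOn_insert {Y : Set V} (h : ConnOn G Y) {y v : V} (hy : y ∈ Y) (hv : G.Adj y v) :
    ConnOn G (insert v Y) := by
  have key : ∀ a ∈ insert v Y, (restrict G (insert v Y)).Reachable y a := by
    rintro a (rfl | ha)
    · exact Adj.reachable ⟨hv, by simp [hy], by simp⟩
    · exact (h y hy a ha).mono (restrict_mono (Set.subset_insert _ _))
  exact fun a ha b hb => (key a ha).symm.trans (key b hb)

/-- In a set of large chromatic number, the vertices at some distance (within the set) from some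
vertex form a set of large chromatic number. -/
theorem exists_level {X : Set V} {n : ℕ} (h : ¬ ColorableOn G X (2 * n)) :
    ∃ z ∈ X, ∃ k, ¬ ColorableOn G
      {x | (restrict G X).Reachable z x ∧ (restrict G X).dist z x = k} n := by
  classical
  by_contra! hc
  set H := restrict G X with hH
  have hex : ∀ z k, ∃ f : V → ℕ, z ∈ X → (∀ v, H.Reachable z v → H.dist z v = k → f v < n) ∧
      ∀ u, H.Reachable z u → H.dist z u = k → ∀ v, H.Reachable z v → H.dist z v = k →
        G.Adj u v → f u ≠ f v := by
    intro z k
    by_cases hz : z ∈ X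
    · obtain ⟨f, hf, hp⟩ := hc z hz k
      exact ⟨f, fun _ => ⟨fun v h1 h2 => hf v ⟨h1, h2⟩,
        fun u h1 h2 v h3 h4 => hp u ⟨h1, h2⟩ v ⟨h3, h4⟩⟩⟩
    · exact ⟨fun _ => 0, fun h => absurd h hz⟩
  choose f hf using hex
  let ρ : V → V := fun v => (H.connectedComponentMk v).out
  have hρ : ∀ v, H.Reachable (ρ v) v := fun v =>
    ConnectedComponent.exact ((H.connectedComponentMk v).out_eq)
  have hρX : ∀ v ∈ X, ρ v ∈ X := fun v hv => mem_of_restrict_reachable (hρ v).symm hv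
  -- Distances to the representative `ρ v` of the component differ by at most one along an edge, so
  -- two palettes of size `n`, used according to parity, suffice.
  refine h ⟨fun v => f (ρ v) (H.dist (ρ v) v) v + (H.dist (ρ v) v % 2) * n, ?_, ?_⟩
  · intro v hv
    have h1 := (hf (ρ v) (H.dist (ρ v) v) (hρX v hv)).1 v (hρ v) rfl
    have h2 : H.dist (ρ v) v % 2 ≤ 1 := by omega
    have h3 : H.dist (ρ v) v % 2 * n ≤ 1 * n := Nat.mul_le_mul_right _ h2
    simp only
    omega
  · intro u hu v hv huv
    have huv' : H.Adj u v := ⟨huv, hu, hv⟩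
    have he : ρ u = ρ v := by
      simp only [ρ]
      rw [ConnectedComponent.sound huv'.reachable]
    have h1 := (hf (ρ u) (H.dist (ρ u) u) (hρX u hu)).1 u (hρ u) rfl
    have h2 := (hf (ρ v) (H.dist (ρ v) v) (hρX v hv)).1 v (hρ v) rfl
    simp only
    have hr : H.Reachable (ρ u) v := he ▸ hρ v
    have hd1 : H.dist (ρ u) v ≤ H.dist (ρ u) u + 1 := by
      have := (hρ u).dist_triangle_left v
      rwa [dist_eq_one_iff_adj.2 huv'] at this
    have hd2 : H.dist (ρ u) u ≤ H.dist (ρ u) v + 1 := by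
      have := hr.dist_triangle_left u
      rwa [dist_eq_one_iff_adj.2 huv'.symm] at this
    rw [← he] at h2 ⊢
    by_cases hd : H.dist (ρ u) u = H.dist (ρ u) v
    · have := (hf (ρ u) (H.dist (ρ u) u) (hρX u hu)).2 u (hρ u) rfl v hr hd.symm huv
      rw [← hd]
      omega
    · rcases (by omega : H.dist (ρ u) u % 2 = 0 ∧ H.dist (ρ u) v % 2 = 1 ∨
        H.dist (ρ u) u % 2 = 1 ∧ H.dist (ρ u) v % 2 = 0) with ⟨h3, h4⟩ | ⟨h3, h4⟩ <;>
      · rw [h3, h4]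
        omega

end Restrict

/-! ### Bounded distance, small balls and scattered vertices. -/

section Near

variable {V : Type*} {G : SimpleGraph V}

/-- `a` and `b` are at distance at most `k`. -/
def Near (G : SimpleGraph V) (k : ℕ) (a b : V) : Prop :=
  ∃ p : G.Walk a b, p.length ≤ k

theorem edist_le_iff_near {k : ℕ} {a b : V} : G.edist a b ≤ (k : ℕ∞) ↔ Near G k a b := by
  constructor
  · intro h
    obtain ⟨p, hp⟩ := exists_walk_of_edist_ne_top (ne_top_of_le_ne_top (ENat.natCast_ne_top k) h)
    refine ⟨p, ?_⟩
    rw [← hp] at h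
    exact_mod_cast h
  · rintro ⟨p, hp⟩
    exact (edist_le p).trans (by exact_mod_cast hp)

theorem Near.refl (k : ℕ) (a : V) : Near G k a a := ⟨Walk.nil, by simp⟩

theorem Near.symm {k : ℕ} {a b : V} (h : Near G k a b) : Near G k b a := by
  obtain ⟨p, hp⟩ := h
  exact ⟨p.reverse, by simpa⟩

theorem Near.trans {j k : ℕ} {a b c : V} (h : Near G j a b) (h' : Near G k b c) :
    Near G (j + k) a c := by
  obtain ⟨p, hp⟩ := h
  obtain ⟨q, hq⟩ := h'
  exact ⟨p.append q, by rw [Walk.length_append]; omega⟩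

theorem Near.mono {j k : ℕ} {a b : V} (h : Near G j a b) (hjk : j ≤ k) : Near G k a b := by
  obtain ⟨p, hp⟩ := h
  exact ⟨p, hp.trans hjk⟩

theorem Near.of_adj {a b : V} (h : G.Adj a b) : Near G 1 a b := ⟨h.toWalk, by simp⟩

theorem near_zero {a b : V} (h : Near G 0 a b) : a = b := by
  obtain ⟨p, hp⟩ := h
  exact Walk.eq_of_length_eq_zero (Nat.le_zero.1 hp)

theorem near_succ {k : ℕ} {a b : V} (h : Near G (k + 1) a b) :
    Near G k a b ∨ ∃ c, Near G k a c ∧ G.Adj c b := by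
  obtain ⟨p, hp⟩ := h.symm
  cases p with
  | nil => exact Or.inl (Near.refl _ _)
  | cons e q =>
    refine Or.inr ⟨_, Near.symm ⟨q, ?_⟩, e.symm⟩
    simpa using hp

theorem ball_eq (k : ℕ) (v : V) : ball G k v = {u | Near G k v u} := by
  ext u
  exact edist_le_iff_near

theorem colorableOn_near_of_chiBall {ρ τ : ℕ} (h : chiBall G ρ ≤ τ) (v : V) :
    ColorableOn G {u | Near G ρ v u} τ := by
  rw [← ball_eq, ← chi_le_iff]
  exact (le_iSup (fun v => chi G (ball G ρ v)) v).trans h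

/-- A set of large chromatic number contains many vertices pairwise far apart. -/
theorem exists_far_points {ρ τ : ℕ} (hτ : ∀ v, ColorableOn G {u | Near G ρ v u} τ) (m : ℕ)
    {X : Set V} (h : ¬ ColorableOn G X (m * τ)) :
    ∃ x : Fin m → V, (∀ i, x i ∈ X) ∧ ∀ i j, i ≠ j → ¬ Near G ρ (x i) (x j) := by
  induction m generalizing X with
  | zero => exact ⟨Fin.elim0, fun i => i.elim0, fun i => i.elim0⟩
  | succ m ih =>
    obtain ⟨a, ha⟩ := nonempty_of_not_colorableOn h
    have h' : ¬ ColorableOn G {v ∈ X | ¬ Near G ρ a v} (m * τ) := by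
      intro hc
      refine h ((hc.union (hτ a)).mono ?_ (by linarith))
      intro v hv
      by_cases hn : Near G ρ a v
      · exact Or.inr hn
      · exact Or.inl ⟨hv, hn⟩
    obtain ⟨x, hx, hfar⟩ := ih h'
    refine ⟨Fin.cons a x, ?_, ?_⟩
    · intro i
      cases i using Fin.cases with
      | zero => simpa using ha
      | succ i => simpa using (hx i).1
    · intro i j hij
      cases i using Fin.cases with
      | zero =>
        cases j using Fin.cases with
        | zero => exact absurd rfl hij
        | succ j => simpa using (hx j).2
      | succ i =>
        cases j using Fin.cases with
        | zero => simpa using fun hn => (hx i).2 (Near.symm hn)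
        | succ j => simpa using hfar i j fun e => hij (by rw [e])

end Near

/-! ### Induced paths through a set. -/

section InducedPaths

variable {V : Type*} {G : SimpleGraph V}

/-- On a shortest path inside `W` the `i`-th vertex is at distance exactly `i` from `a`, so adjacent
vertices of the path are consecutive. -/
theorem exists_induced_path {W : Set V} {a b : V} (h : (restrict G W).Reachable a b)
    (ha : a ∈ W) :
    ∃ p : G.Walk a b, p.IsPath ∧ (∀ x ∈ p.support, x ∈ W) ∧
      ∀ x ∈ p.support, ∀ y ∈ p.support, G.Adj x y → s(x, y) ∈ p.edges := by
  obtain ⟨p, hp, hlen⟩ := h.exists_path_of_dist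
  have hW := support_subset_of_restrict p ha
  have hdist : ∀ i ≤ p.length, (restrict G W).dist a (p.getVert i) = i := by
    intro i hi
    have h1 := dist_le (p.take i)
    have h2 := dist_le (p.drop i)
    have h3 := (p.take i).reachable.dist_triangle_left b
    rw [Walk.take_length] at h1
    rw [Walk.drop_length] at h2
    omega
  refine ⟨p.mapLe (restrict_le W), ?_, ?_, ?_⟩
  · simpa using hp
  · simpa using hW
  · intro x hx y hy hxy
    rw [Walk.support_mapLe_eq_support] at hx hy
    rw [Walk.edges_mapLe_eq_edges]
    have hadj : (restrict G W).Adj x y := ⟨hxy, hW x hx, hW y hy⟩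
    obtain ⟨i, rfl, hi⟩ := Walk.mem_support_iff_exists_getVert.1 hx
    obtain ⟨j, rfl, hj⟩ := Walk.mem_support_iff_exists_getVert.1 hy
    have h1 := (p.take i).reachable.dist_triangle_left (p.getVert j)
    have h2 := (p.take j).reachable.dist_triangle_left (p.getVert i)
    rw [dist_eq_one_iff_adj.2 hadj, hdist i hi, hdist j hj] at h1
    rw [dist_eq_one_iff_adj.2 hadj.symm, hdist i hi, hdist j hj] at h2
    have hij : i ≠ j := by
      rintro rfl
      exact G.loopless.irrefl _ hxy
    have key : ∀ k, k + 1 ≤ p.length → s(p.getVert k, p.getVert (k + 1)) ∈ p.edges := by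
      intro k hk
      rw [Walk.edges, List.mem_map]
      have hk' : k < p.darts.length := by rw [Walk.length_darts]; omega
      exact ⟨_, List.getElem_mem hk', by rw [Walk.darts_getElem_eq_getVert]; rfl⟩
    rcases (by omega : j = i + 1 ∨ i = j + 1) with rfl | rfl
    · exact key i hj
    · rw [Sym2.eq_swap]
      exact key j hi

/-- An induced path through `W` between two nonadjacent vertices, cut at an inner vertex. -/
theorem exists_two_legs {W : Set V} {a b : V}
    (h : (restrict G (insert a (insert b W))).Reachable a b) (hab : a ≠ b) (hadj : ¬ G.Adj a b)
    (ha : a ∉ W) :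
    ∃ m ∈ W, ∃ (p : G.Walk a m) (q : G.Walk b m), p.IsPath ∧ q.IsPath ∧
      (∀ x ∈ p.support, x = a ∨ x ∈ W) ∧ (∀ x ∈ q.support, x = b ∨ x ∈ W) ∧
      (∀ x ∈ p.support, x ∈ q.support → x = m) ∧
      ∀ x y, (x ∈ p.support ∨ x ∈ q.support) → (y ∈ p.support ∨ y ∈ q.support) → G.Adj x y →
        s(x, y) ∈ p.edges ∨ s(x, y) ∈ q.edges := by
  obtain ⟨P, hP, hW, hind⟩ := exists_induced_path h (Set.mem_insert _ _)
  cases P with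
  | nil => exact absurd rfl hab
  | @cons _ m _ e P =>
    rw [Walk.cons_isPath_iff] at hP
    simp only [Walk.support_cons, List.mem_cons, Walk.edges_cons] at hW hind
    have hm : m ∈ W := by
      rcases hW m (Or.inr P.start_mem_support) with rfl | rfl | hm
      · exact absurd e (G.loopless.irrefl _)
      · exact absurd e hadj
      · exact hm
    -- The cut is at the second vertex: one leg is the first edge, the other is the rest of the path
    -- reversed.
    refine ⟨m, hm, e.toWalk, P.reverse, ?_, hP.1.reverse, ?_, ?_, ?_, ?_⟩
    · have hne : a ≠ m := e.ne
      simpa using hne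
    · intro x hx
      simp only [Walk.support_cons, Walk.support_nil, List.mem_cons, List.not_mem_nil, or_false]
        at hx
      rcases hx with rfl | rfl
      · exact Or.inl rfl
      · exact Or.inr hm
    · intro x hx
      rw [Walk.support_reverse, List.mem_reverse] at hx
      rcases hW x (Or.inr hx) with rfl | hx'
      · exact absurd hx hP.2
      · exact hx'
    · intro x hx hx'
      simp only [Walk.support_cons, Walk.support_nil, List.mem_cons, List.not_mem_nil, or_false]
        at hx
      rw [Walk.support_reverse, List.mem_reverse] at hx'
      rcases hx with rfl | rfl
      · exact absurd hx' hP.2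
      · rfl
    · intro x y hx hy hxy
      have hmem : ∀ z, (z ∈ e.toWalk.support ∨ z ∈ P.reverse.support) → z = a ∨ z ∈ P.support := by
        intro z hz
        simp only [Walk.support_cons, Walk.support_nil, List.mem_cons, List.not_mem_nil, or_false,
          Walk.support_reverse, List.mem_reverse] at hz
        rcases hz with (rfl | rfl) | hz
        · exact Or.inl rfl
        · exact Or.inr P.start_mem_support
        · exact Or.inr hz
      rcases hind x (hmem x hx) y (hmem y hy) hxy with h | h
      · left
        simp [h]
      · right
        simpa using h

end InducedPaths

/-! ### Induced subdivisions of a once-subdivided complete graph. -/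

section Subdivide

variable {V : Type*} {G : SimpleGraph V}

/-- Two sets are disjoint and there is no edge between them. -/
def Apart (G : SimpleGraph V) (A B : Set V) : Prop :=
  ∀ a ∈ A, ∀ b ∈ B, a ≠ b ∧ ¬ G.Adj a b

theorem Apart.symm {A B : Set V} (h : Apart G A B) : Apart G B A :=
  fun b hb a ha => ⟨(h a ha b hb).1.symm, fun e => (h a ha b hb).2 e.symm⟩

theorem oneSubdivision_adj_inl_inr {U : Type*} {H : SimpleGraph U} {a : U} {e : H.edgeSet} :
    (oneSubdivision H).Adj (Sum.inl a) (Sum.inr e) ↔ a ∈ e.1 := by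
  simp [oneSubdivision]

theorem oneSubdivision_adj_inr_inl {U : Type*} {H : SimpleGraph U} {a : U} {e : H.edgeSet} :
    (oneSubdivision H).Adj (Sum.inr e) (Sum.inl a) ↔ a ∈ e.1 := by
  simp [oneSubdivision]

theorem oneSubdivision_not_adj_inl_inl {U : Type*} {H : SimpleGraph U} {a b : U} :
    ¬ (oneSubdivision H).Adj (Sum.inl a) (Sum.inl b) := by
  simp [oneSubdivision]

theorem oneSubdivision_not_adj_inr_inr {U : Type*} {H : SimpleGraph U} {a b : H.edgeSet} :
    ¬ (oneSubdivision H).Adj (Sum.inr a) (Sum.inr b) := by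
  simp [oneSubdivision]

/-- The path replacing an oriented edge of a one-subdivision, given the paths that leave the
vertices of the original graph. -/
def oneSubdivisionPath {U W : Type*} {H : SimpleGraph U} {J : SimpleGraph W}
    (br : U ⊕ H.edgeSet → W)
    (leg : ∀ (e : H.edgeSet) (a : U), a ∈ e.1 → J.Walk (br (Sum.inl a)) (br (Sum.inr e))) :
    ∀ x y, (oneSubdivision H).Adj x y → J.Walk (br x) (br y)
  | Sum.inl a, Sum.inr e, h => leg e a (oneSubdivision_adj_inl_inr.1 h)
  | Sum.inr e, Sum.inl a, h => (leg e a (oneSubdivision_adj_inr_inl.1 h)).reverse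
  | Sum.inl _, Sum.inl _, h => absurd h oneSubdivision_not_adj_inl_inl
  | Sum.inr _, Sum.inr _, h => absurd h oneSubdivision_not_adj_inr_inr

/-- Every dart of a one-subdivision is, up to orientation, the pair of a vertex and an edge. -/
theorem exists_leg_of_dart {U W : Type*} {H : SimpleGraph U} {J : SimpleGraph W}
    (br : U ⊕ H.edgeSet → W)
    (leg : ∀ (e : H.edgeSet) (a : U), a ∈ e.1 → J.Walk (br (Sum.inl a)) (br (Sum.inr e)))
    (d : (oneSubdivision H).Dart) :
    ∃ (e : H.edgeSet) (a : U) (h : a ∈ e.1), d.edge = s(Sum.inl a, Sum.inr e) ∧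
      ((d.fst = Sum.inl a ∧ d.snd = Sum.inr e) ∨ (d.fst = Sum.inr e ∧ d.snd = Sum.inl a)) ∧
      ∀ x, x ∈ (oneSubdivisionPath br leg d.fst d.snd d.adj).support ↔ x ∈ (leg e a h).support := by
  obtain ⟨⟨x, y⟩, h⟩ := d
  rcases x with a | e <;> rcases y with b | f
  · exact absurd h oneSubdivision_not_adj_inl_inl
  · exact ⟨f, a, oneSubdivision_adj_inl_inr.1 h, rfl, Or.inl ⟨rfl, rfl⟩, fun x => Iff.rfl⟩
  · refine ⟨e, b, oneSubdivision_adj_inr_inl.1 h, Sym2.eq_swap, Or.inr ⟨rfl, rfl⟩, fun x => ?_⟩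
    simp [oneSubdivisionPath]
  · exact absurd h oneSubdivision_not_adj_inr_inr

/-- A subdivision of a one-subdivision, from the paths that leave the original vertices. -/
def Subdivision.ofLegs {U W : Type*} {H : SimpleGraph U} {J : SimpleGraph W}
    (br : U ⊕ H.edgeSet ↪ W)
    (leg : ∀ (e : H.edgeSet) (a : U), a ∈ e.1 → J.Walk (br (Sum.inl a)) (br (Sum.inr e)))
    (hpath : ∀ e a h, (leg e a h).IsPath)
    (hdisj : ∀ e a h f b k, (e, a) ≠ (f, b) → ∀ x, x ∈ (leg e a h).support →
      x ∈ (leg f b k).support → (x = br (Sum.inl a) ∨ x = br (Sum.inr e)) ∧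
        (x = br (Sum.inl b) ∨ x = br (Sum.inr f)))
    (hbr : ∀ e a h v, br v ∈ (leg e a h).support → v = Sum.inl a ∨ v = Sum.inr e)
    (hvert : ∀ x, (∃ v, br v = x) ∨ ∃ e a h, x ∈ (leg e a h).support)
    (hedge : ∀ x y, J.Adj x y → ∃ e a h, s(x, y) ∈ (leg e a h).edges) :
    Subdivision J (oneSubdivision H) where
  branch := br
  path d := oneSubdivisionPath br leg d.fst d.snd d.adj
  isPath d := by
    obtain ⟨⟨x, y⟩, h⟩ := d
    rcases x with a | e <;> rcases y with b | f
    · exact absurd h oneSubdivision_not_adj_inl_inl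
    · exact hpath _ _ _
    · exact (hpath _ _ _).reverse
    · exact absurd h oneSubdivision_not_adj_inr_inr
  path_symm d := by
    obtain ⟨⟨x, y⟩, h⟩ := d
    rcases x with a | e <;> rcases y with b | f
    · exact absurd h oneSubdivision_not_adj_inl_inl
    · rfl
    · exact (Walk.reverse_reverse _).symm
    · exact absurd h oneSubdivision_not_adj_inr_inr
  disjoint d d' hne x hx hx' := by
    obtain ⟨e, a, h, he, hd, hs⟩ := exists_leg_of_dart br leg d
    obtain ⟨f, b, k, hf, hd', hs'⟩ := exists_leg_of_dart br leg d'
    have := hdisj e a h f b k (by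
      rintro ⟨⟩
      exact hne (he.trans hf.symm)) x ((hs x).1 hx) ((hs' x).1 hx')
    rcases hd with ⟨h1, h2⟩ | ⟨h1, h2⟩ <;> rcases hd' with ⟨h3, h4⟩ | ⟨h3, h4⟩ <;>
      rw [h1, h2, h3, h4] <;> tauto
  branch_mem d v hv := by
    obtain ⟨e, a, h, -, hd, hs⟩ := exists_leg_of_dart br leg d
    have := hbr e a h v ((hs _).1 hv)
    rcases hd with ⟨h1, h2⟩ | ⟨h1, h2⟩ <;> rw [h1, h2] <;> tauto
  vertex_mem x := by
    rcases hvert x with h | ⟨e, a, h, hx⟩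
    · exact Or.inl h
    · exact Or.inr ⟨⟨(Sum.inl a, Sum.inr e), oneSubdivision_adj_inl_inr.2 h⟩, hx⟩
  edge_mem := by
    intro z hz
    induction z with
    | _ x y =>
    obtain ⟨e, a, h, hx⟩ := hedge x y hz
    exact ⟨⟨(Sum.inl a, Sum.inr e), oneSubdivision_adj_inl_inr.2 h⟩, hx⟩

/-- The vertex `m` will be the branch vertex that subdivides the pair `e`. Legs are indexed by
membership in `e`, so neither end of the unordered pair is singled out. -/
theorem exists_legs {ν : ℕ} (s : Fin ν → V) (W : Set V) (e : Sym2 (Fin ν)) (he : ¬ e.IsDiag)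
    (hs : ∀ a b, a ≠ b → s a ≠ s b ∧ ¬ G.Adj (s a) (s b)) (hsW : ∀ a, s a ∉ W)
    (hreach : ∀ a b, e = s(a, b) →
      (restrict G (insert (s a) (insert (s b) W))).Reachable (s a) (s b)) :
    ∃ m ∈ W, ∃ leg : ∀ a ∈ e, G.Walk (s a) m, (∀ a h, (leg a h).IsPath) ∧
      (∀ a h, ∀ x ∈ (leg a h).support, x = s a ∨ x ∈ W) ∧
      (∀ a h b k, a ≠ b → ∀ x, x ∈ (leg a h).support → x ∈ (leg b k).support → x = m) ∧
      ∀ x y, (∃ a h, x ∈ (leg a h).support) → (∃ a h, y ∈ (leg a h).support) → G.Adj x y →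
        ∃ a h, s(x, y) ∈ (leg a h).edges := by
  induction e with
  | _ a b =>
  have hab : a ≠ b := by simpa using he
  obtain ⟨m, hm, p, q, hp, hq, hpW, hqW, hpq, hE⟩ :=
    exists_two_legs (hreach a b rfl) (hs a b hab).1 (hs a b hab).2 (hsW a)
  have hleg : ∃ leg : ∀ c ∈ s(a, b), G.Walk (s c) m, leg a (by simp) = p ∧
      leg b (by simp) = q := by
    refine ⟨fun c hc => if h : c = a then p.copy (by rw [h]) rfl else
      q.copy (by rw [(Sym2.mem_iff.1 hc).resolve_left h]) rfl, ?_, ?_⟩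
    · simp
    · simp [hab.symm]
  obtain ⟨leg, rfl, rfl⟩ := hleg
  refine ⟨m, hm, leg, ?_, ?_, ?_, ?_⟩
  · intro c hc
    rcases Sym2.mem_iff.1 hc with rfl | rfl
    exacts [hp, hq]
  · intro c hc
    rcases Sym2.mem_iff.1 hc with rfl | rfl
    exacts [hpW, hqW]
  · intro c hc d hd hcd x hx hx'
    rcases Sym2.mem_iff.1 hc with rfl | rfl <;> rcases Sym2.mem_iff.1 hd with rfl | rfl
    exacts [absurd rfl hcd, hpq x hx hx', hpq x hx' hx, absurd rfl hcd]
  · have key : ∀ x, (∃ c h, x ∈ (leg c h).support) →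
        x ∈ (leg a (by simp)).support ∨ x ∈ (leg b (by simp)).support := by
      rintro x ⟨c, hc, hx⟩
      rcases Sym2.mem_iff.1 hc with rfl | rfl
      exacts [Or.inl hx, Or.inr hx]
    intro x y hx hy hxy
    rcases hE x y (key x hx) (key y hy) hxy with h | h
    exacts [⟨a, by simp, h⟩, ⟨b, by simp, h⟩]

theorem mem_support_induce {S : Set V} {a b : V} (p : G.Walk a b) (hp : ∀ x ∈ p.support, x ∈ S)
    (x : S) : x ∈ (p.induce S hp).support ↔ x.1 ∈ p.support := by
  rw [Walk.support_induce, List.mem_attachWith]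

theorem mem_edges_induce {S : Set V} {a b : V} (p : G.Walk a b) (hp : ∀ x ∈ p.support, x ∈ S)
    (x y : S) (h : s(x.1, y.1) ∈ p.edges) : s(x, y) ∈ (p.induce S hp).edges := by
  have key : ∀ {a b : V} (p : G.Walk a b) (hp : ∀ x ∈ p.support, x ∈ S),
      (p.induce S hp).edges.map (Sym2.map Subtype.val) = p.edges := by
    intro a b p
    induction p with
    | nil => intro hp; rfl
    | cons e p ih =>
      intro hp
      have := ih fun x hx => hp x (by simp [hx])
      rw [Walk.induce_cons, Walk.edges_cons, List.map_cons, this, Walk.edges_cons]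
      rfl
  rw [← key p hp, List.mem_map] at h
  obtain ⟨z, hz, he⟩ := h
  have : z = s(x, y) := Sym2.map.injective Subtype.val_injective he
  exact this ▸ hz

theorem isPath_induce {S : Set V} {a b : V} (p : G.Walk a b) (hp : ∀ x ∈ p.support, x ∈ S)
    (h : p.IsPath) : (p.induce S hp).IsPath := by
  rw [Walk.isPath_def] at h ⊢
  rw [Walk.support_induce]
  refine List.Nodup.of_map Subtype.val ?_
  rwa [List.attachWith_map_subtype_val]

/-- Pairwise linking of `ν` nonadjacent vertices through pairwise anticomplete sets gives an
induced subdivision of `K_ν^1`. -/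
theorem not_subdivisionFree_of_links {ν : ℕ} (s : Fin ν → V) (W : Sym2 (Fin ν) → Set V)
    (hs : ∀ a b, a ≠ b → s a ≠ s b ∧ ¬ G.Adj (s a) (s b))
    (hW : ∀ e f, e ≠ f → Apart G (W e) (W f))
    (hsW : ∀ a e, s a ∉ W e) (hsW' : ∀ a e, a ∉ e → ∀ w ∈ W e, ¬ G.Adj (s a) w)
    (hreach : ∀ a b, a ≠ b →
      (restrict G (insert (s a) (insert (s b) (W s(a, b))))).Reachable (s a) (s b)) :
    ¬ SubdivisionFree (subdividedComplete ν) G := by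
  intro hfree
  have hE : ∀ e : (⊤ : SimpleGraph (Fin ν)).edgeSet, ¬ e.1.IsDiag := fun e =>
    not_isDiag_of_mem_edgeSet _ e.2
  choose m hm leg hpath hsub hmeet hind using fun e : (⊤ : SimpleGraph (Fin ν)).edgeSet =>
    exists_legs s (W e.1) e.1 (hE e) hs (fun a => hsW a _) (fun a b hab => by
      rw [hab]
      exact hreach a b (by
        rintro rfl
        exact hE e (by rw [hab]; simp)))
  let br : Fin ν ⊕ (⊤ : SimpleGraph (Fin ν)).edgeSet → V := Sum.elim s m
  have hsinj : ∀ {a b}, s a = s b → a = b := fun {a b} h => by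
    by_contra hab
    exact (hs a b hab).1 h
  have hWeq : ∀ {e f : (⊤ : SimpleGraph (Fin ν)).edgeSet} {x}, x ∈ W e.1 → x ∈ W f.1 → e = f := by
    intro e f x hx hx'
    by_contra hef
    exact (hW e.1 f.1 (fun h => hef (Subtype.ext h)) x hx x hx').1 rfl
  have hinj : Function.Injective br := by
    rintro (a | e) (b | f) h
    · exact congrArg _ (hsinj h)
    · exact absurd (show s a ∈ W f.1 by rw [show s a = m f from h]; exact hm f) (hsW a _)
    · exact absurd (show s b ∈ W e.1 by rw [← show m e = s b from h]; exact hm e) (hsW b _)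
    · exact congrArg _ (hWeq (hm e) (by rw [show m e = m f from h]; exact hm f))
  let S : Set V := {x | (∃ v, br v = x) ∨ ∃ e a h, x ∈ (leg e a h).support}
  have hS : ∀ e a h, ∀ x ∈ (leg e a h).support, x ∈ S := fun e a h x hx =>
    Or.inr ⟨e, a, h, hx⟩
  let br' : Fin ν ⊕ (⊤ : SimpleGraph (Fin ν)).edgeSet ↪ S :=
    ⟨fun v => ⟨br v, Or.inl ⟨v, rfl⟩⟩, fun v w h => hinj (congrArg Subtype.val h)⟩
  obtain ⟨leg', hpath', hsupp', hedge'⟩ :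
      ∃ leg' : ∀ (e : (⊤ : SimpleGraph (Fin ν)).edgeSet) (a : Fin ν), a ∈ e.1 →
        (G.induce S).Walk (br' (Sum.inl a)) (br' (Sum.inr e)),
      (∀ e a h, (leg' e a h).IsPath) ∧
      (∀ e a h x, x ∈ (leg' e a h).support ↔ x.1 ∈ (leg e a h).support) ∧
      ∀ e a h x y, s(x.1, y.1) ∈ (leg e a h).edges → s(x, y) ∈ (leg' e a h).edges :=
    ⟨fun e a h => (leg e a h).induce S (hS e a h),
      fun e a h => isPath_induce _ _ (hpath e a h),
      fun e a h x => mem_support_induce (leg e a h) (hS e a h) x,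
      fun e a h x y => mem_edges_induce (leg e a h) (hS e a h) x y⟩
  refine (hfree S).false (Subdivision.ofLegs br' leg' hpath' ?_ ?_ ?_ ?_)
  · intro e a h f b k hne x hx hx'
    rw [hsupp'] at hx hx'
    have key : ∀ e a h, x.1 ∈ (leg e a h).support → x.1 = s a ∨ x.1 ∈ W e.1 := fun e a h =>
      hsub e a h x.1
    suffices h : (x.1 = s a ∨ x.1 = m e) ∧ (x.1 = s b ∨ x.1 = m f) from
      ⟨h.1.imp Subtype.ext Subtype.ext, h.2.imp Subtype.ext Subtype.ext⟩
    by_cases hef : e = f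
    · subst hef
      have hab : a ≠ b := fun hab => hne (by rw [hab])
      have := hmeet e a h b k hab _ hx hx'
      exact ⟨Or.inr this, Or.inr this⟩
    · rcases key e a h hx with h1 | h1 <;> rcases key f b k hx' with h2 | h2
      · exact ⟨Or.inl h1, Or.inl h2⟩
      · exact absurd (h1 ▸ h2) (hsW a _)
      · exact absurd (h2 ▸ h1) (hsW b _)
      · exact absurd (hWeq h1 h2) hef
  · intro e a h v hv
    rw [hsupp'] at hv
    rcases v with b | f
    · rcases hsub e a h _ hv with h1 | h1
      · exact Or.inl (congrArg _ (hsinj h1))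
      · exact absurd h1 (hsW b _)
    · rcases hsub e a h _ hv with h1 | h1
      · exact absurd (show s a ∈ W f.1 by rw [← show m f = s a from h1]; exact hm f) (hsW a _)
      · exact Or.inr (congrArg _ (hWeq (hm f) h1))
  · rintro ⟨x, ⟨v, rfl⟩ | ⟨e, a, h, hx⟩⟩
    · exact Or.inl ⟨v, rfl⟩
    · exact Or.inr ⟨e, a, h, (hsupp' _ _ _ _).2 hx⟩
  · rintro ⟨x, hx⟩ ⟨y, hy⟩ hxy
    replace hxy : G.Adj x y := hxy
    have key : ∀ z ∈ S, (∃ a, z = s a) ∨ ∃ e, z ∈ W e.1 ∧ ∃ a h, z ∈ (leg e a h).support := by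
      rintro z (⟨a | e, rfl⟩ | ⟨e, a, h, hz⟩)
      · exact Or.inl ⟨a, rfl⟩
      · obtain ⟨a, ha⟩ : ∃ a, a ∈ e.1 := ⟨_, Sym2.out_fst_mem e.1⟩
        exact Or.inr ⟨e, hm e, a, ha, (leg e a ha).end_mem_support⟩
      · rcases hsub e a h z hz with h1 | h1
        · exact Or.inl ⟨a, h1⟩
        · exact Or.inr ⟨e, h1, a, h, hz⟩
    have fin : ∀ e : (⊤ : SimpleGraph (Fin ν)).edgeSet, (∃ a h, x ∈ (leg e a h).support) →
        (∃ a h, y ∈ (leg e a h).support) → ∃ e a h, s((⟨x, hx⟩ : S), (⟨y, hy⟩ : S)) ∈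
          (leg' e a h).edges := by
      intro e h1 h2
      obtain ⟨a, h, hE⟩ := hind e x y h1 h2 hxy
      exact ⟨e, a, h, hedge' _ _ _ _ _ hE⟩
    have start : ∀ e : (⊤ : SimpleGraph (Fin ν)).edgeSet, ∀ a, a ∈ e.1 →
        ∃ b h, s a ∈ (leg e b h).support := fun e a h => ⟨a, h, (leg e a h).start_mem_support⟩
    rcases key x hx with ⟨a, rfl⟩ | ⟨e, he, hxe⟩ <;> rcases key y hy with ⟨b, rfl⟩ | ⟨f, hf, hyf⟩
    · have hab : a ≠ b := by
        rintro rfl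
        exact G.loopless.irrefl _ hxy
      exact absurd hxy (hs a b hab).2
    · by_cases ha : a ∈ f.1
      · exact fin f (start f a ha) hyf
      · exact absurd hxy (hsW' a f.1 ha y hf)
    · by_cases hb : b ∈ e.1
      · exact fin e hxe (start e b hb)
      · exact absurd hxy.symm (hsW' b e.1 hb x he)
    · by_cases hef : e = f
      · subst hef
        exact fin e hxe hyf
      · exact absurd hxy (hW e.1 f.1 (fun h => hef (Subtype.ext h)) x he y hf).2

end Subdivide

/-! ### Spiders attached to a common family of connected sets. -/

section Grid

variable {V : Type*} {G : SimpleGraph V}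

/-- Many spiders, attached to the same family of pairwise anticomplete connected sets, give an
induced subdivision of `K_ν^1`. -/
theorem not_subdivisionFree_of_grid {ν : ℕ} (s : Fin ν → V) (Y : Sym2 (Fin ν) → Set V)
    (R : Fin ν → Sym2 (Fin ν) → Set V) (hY : ∀ e, ConnOn G (Y e))
    (hYY : ∀ e f, e ≠ f → Apart G (Y e) (Y f)) (hR : ∀ a e, ConnOn G (R a e))
    (hsR : ∀ a e, ∃ r ∈ R a e, G.Adj (s a) r) (hRY : ∀ a e, ∃ r ∈ R a e, ∃ y ∈ Y e, G.Adj r y)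
    (hRY' : ∀ a e f, e ≠ f → Apart G (R a e) (Y f))
    (hsY : ∀ a e, Apart G {s a} (Y e))
    (hRR : ∀ a e f, e ≠ f → Apart G (R a e) (R a f)) (hsR' : ∀ a e, s a ∉ R a e)
    (hab : ∀ a b, a ≠ b → ∀ e f, Apart G (insert (s a) (R a e)) (insert (s b) (R b f))) :
    ¬ SubdivisionFree (subdividedComplete ν) G := by
  -- The pair `ab` is linked along `s a`, `R a e`, `Y e`, `R b e`, `s b`. The legs `R c e` with `c ∉
  -- e` are dropped, which leaves `s c` without neighbours in `W e`.
  let W : Sym2 (Fin ν) → Set V := fun e => Y e ∪ {x | ∃ a ∈ e, x ∈ R a e}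
  have hRR' : ∀ a b e f, e ≠ f → Apart G (R a e) (R b f) := by
    intro a b e f hef
    by_cases h : a = b
    · subst h
      exact hRR a e f hef
    · exact fun x hx y hy => hab a b h e f x (Or.inr hx) y (Or.inr hy)
  refine not_subdivisionFree_of_links s W ?_ ?_ ?_ ?_ ?_
  · intro a b h
    exact hab a b h s(a, a) s(a, a) _ (Or.inl rfl) _ (Or.inl rfl)
  · rintro e f hef x (hx | ⟨a, -, hx⟩) y (hy | ⟨b, -, hy⟩)
    · exact hYY e f hef x hx y hy
    · exact (hRY' b f e hef.symm).symm x hx y hy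
    · exact hRY' a e f hef x hx y hy
    · exact hRR' a b e f hef x hx y hy
  · rintro a e (h | ⟨b, -, h⟩)
    · exact (hsY a e _ rfl _ h).1 rfl
    · by_cases hb : a = b
      · subst hb
        exact hsR' a e h
      · exact (hab a b hb e e _ (Or.inl rfl) _ (Or.inr h)).1 rfl
  · rintro a e hae w (h | ⟨b, hb, h⟩)
    · exact (hsY a e _ rfl _ h).2
    · have hne : a ≠ b := by
        rintro rfl
        exact hae hb
      exact (hab a b hne e e _ (Or.inl rfl) _ (Or.inr h)).2
  · intro a b h
    set U := insert (s a) (insert (s b) (W s(a, b))) with hU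
    have hYU : Y s(a, b) ⊆ U := fun y hy => Or.inr (Or.inr (Or.inl hy))
    have key : ∀ c ∈ s(a, b), s c ∈ U → ∀ y ∈ Y s(a, b), (restrict G U).Reachable (s c) y := by
      intro c hc hsc y hy
      have hRU : R c s(a, b) ⊆ U := fun r hr => Or.inr (Or.inr (Or.inr ⟨c, hc, hr⟩))
      obtain ⟨r, hr, h1⟩ := hsR c s(a, b)
      obtain ⟨r', hr', y', hy', h2⟩ := hRY c s(a, b)
      have e1 : (restrict G U).Adj (s c) r := ⟨h1, hsc, hRU hr⟩
      have e2 := (hR c s(a, b) r hr r' hr').mono (restrict_mono hRU)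
      have e3 : (restrict G U).Adj r' y' := ⟨h2, hRU hr', hYU hy'⟩
      have e4 := (hY s(a, b) y' hy' y hy).mono (restrict_mono hYU)
      exact ((e1.reachable.trans e2).trans e3.reachable).trans e4
    obtain ⟨-, -, y, hy, -⟩ := hRY a s(a, b)
    exact (key a (by simp) (Or.inl rfl) y hy).trans
      (key b (by simp) (Or.inr (Or.inl rfl)) y hy).symm

end Grid

/-! ### Induced spiders made of geodesics. -/

section Spiders

universe u v

/-- Many vertices at the same distance from `u` give an induced spider, all of whose leaves are
among these vertices, with legs along geodesics from `u`. -/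
theorem exists_spider (τ N t : ℕ) : ∃ n : ℕ, ∀ (V : Type u) (G : SimpleGraph V) (ι : Type v)
    (u : V) (S : Finset ι) (q : ι → V), ColorableOn G {v | Near G t u v} τ →
    Set.InjOn q S → (∀ i ∈ S, Near G t u (q i)) → (∀ i ∈ S, ∀ j, Near G j u (q i) → t ≤ j) →
    n ≤ S.card →
    ∃ (s : V) (S' : Finset ι) (R : ι → Set V), S' ⊆ S ∧ S'.card = N ∧ (∃ a < t, Near G a u s) ∧
      ∀ i ∈ S', q i ∈ R i ∧ ConnOn G (R i) ∧ (∃ r ∈ R i, G.Adj s r) ∧ s ∉ R i ∧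
        (∀ x ∈ R i, ∃ a b, a + b = t ∧ Near G a u x ∧ Near G b x (q i)) ∧
        ∀ j ∈ S', i ≠ j → Apart G (R i) (R j) := by
  classical
  induction t with
  | zero =>
    refine ⟨2, fun V G ι u S q _ hinj hq _ hS => ?_⟩
    obtain ⟨i, hi, j, hj, hij⟩ := Finset.one_lt_card.1 hS
    exact absurd (hinj hi hj ((near_zero (hq i hi)).symm.trans (near_zero (hq j hj)))) hij
  | succ t ih =>
    obtain ⟨n, hn⟩ := ih
    -- If every vertex `p` within distance `t` of `u` is adjacent to at most `τ * N` of the `q i`,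
    -- then more than `τ * n` such vertices are needed to dominate them, and `n` of these have
    -- private neighbours of one colour. If some `p` is adjacent to more, then `N` of its neighbours
    -- share a colour and give a star at `p`.
    refine ⟨τ * n * (τ * N) + 1, fun V G ι u S q hcol hinj hq hq' hS => ?_⟩
    obtain ⟨f, hf, hp⟩ := hcol
    have : Nonempty V := ⟨u⟩
    have : Nonempty ι := (Finset.card_pos.1 (by omega : 0 < S.card)).to_type
    by_cases hbig : ∃ p, Near G t u p ∧ τ * N < (S.filter fun i => G.Adj p (q i)).card
    · obtain ⟨p, hpu, hp'⟩ := hbig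
      obtain ⟨k, -, hk⟩ := Finset.exists_lt_card_fiber_of_mul_lt_card_of_maps_to
        (t := Finset.range τ) (f := fun i => f (q i)) (n := N)
        (fun i hi => Finset.mem_range.2 (hf _ (hq i (Finset.mem_filter.1 hi).1)))
        (by simpa using hp')
      obtain ⟨S', hS', hcard⟩ := Finset.exists_subset_card_eq hk.le
      have hmem : ∀ i ∈ S', i ∈ S ∧ G.Adj p (q i) ∧ f (q i) = k := fun i hi => by
        have := hS' hi
        simp only [Finset.mem_filter] at this
        tauto
      refine ⟨p, S', fun i => {q i}, fun i hi => (hmem i hi).1, hcard, ⟨t, by omega, hpu⟩, ?_⟩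
      intro i hi
      refine ⟨rfl, connOn_singleton _, ⟨_, rfl, (hmem i hi).2.1⟩, ?_, ?_, ?_⟩
      · exact (hmem i hi).2.1.ne
      · rintro x rfl
        exact ⟨t + 1, 0, rfl, hq i (hmem i hi).1, Near.refl _ _⟩
      · rintro j hj hij x rfl y rfl
        refine ⟨fun e => hij (hinj (hmem i hi).1 (hmem j hj).1 e), fun e => ?_⟩
        exact hp _ (hq i (hmem i hi).1) _ (hq j (hmem j hj).1) e
          ((hmem i hi).2.2.trans (hmem j hj).2.2.symm)
    · push Not at hbig
      have hpar : ∀ i ∈ S, ∃ p, Near G t u p ∧ G.Adj p (q i) := by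
        intro i hi
        rcases near_succ (hq i hi) with h | h
        · have := hq' i hi t h
          omega
        · exact h
      -- Minimality of a dominating set gives each of its members a private neighbour `q (w p)`; the
      -- induction is applied to the members themselves.
      let Dom : Set (Finset V) :=
        {P | (∀ p ∈ P, Near G t u p) ∧ ∀ i ∈ S, ∃ p ∈ P, G.Adj p (q i)}
      have hne : Dom.Nonempty := by
        choose! par hpar1 hpar2 using hpar
        refine ⟨S.image par, ?_, fun i hi => ⟨par i, Finset.mem_image_of_mem _ hi, hpar2 i hi⟩⟩
        intro p hp
        obtain ⟨i, hi, rfl⟩ := Finset.mem_image.1 hp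
        exact hpar1 i hi
      obtain ⟨P, ⟨hPu, hPS⟩, hmin⟩ := (measure Finset.card).wf.has_min Dom hne
      have hpriv : ∀ p ∈ P, ∃ i ∈ S, G.Adj p (q i) ∧ ∀ p' ∈ P, p' ≠ p → ¬ G.Adj p' (q i) := by
        intro p hpP
        have hlt : (P.erase p).card < P.card := Finset.card_erase_lt_of_mem hpP
        by_contra! hc
        refine hmin (P.erase p) ⟨fun p' hp' => hPu p' (Finset.mem_of_mem_erase hp'), ?_⟩ hlt
        intro i hi
        obtain ⟨p₀, hp₀, hadj⟩ := hPS i hi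
        by_cases h : p₀ = p
        · subst h
          obtain ⟨p', hp', hne', hadj'⟩ := hc i hi hadj
          exact ⟨p', Finset.mem_erase.2 ⟨hne', hp'⟩, hadj'⟩
        · exact ⟨p₀, Finset.mem_erase.2 ⟨h, hp₀⟩, hadj⟩
      choose! w hwS hwadj hwpriv using hpriv
      have hPcard : τ * n < P.card := by
        have h1 : S.card ≤ P.card * (τ * N) := by
          calc S.card ≤ (P.biUnion fun p => S.filter fun i => G.Adj p (q i)).card := by
                refine Finset.card_le_card fun i hi => ?_
                obtain ⟨p, hp, hadj⟩ := hPS i hi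
                exact Finset.mem_biUnion.2 ⟨p, hp, Finset.mem_filter.2 ⟨hi, hadj⟩⟩
            _ ≤ P.card * (τ * N) :=
                Finset.card_biUnion_le_card_mul _ _ _ fun p hp => hbig p (hPu p hp)
        by_contra hc
        have := Nat.mul_le_mul_right (τ * N) (not_lt.1 hc)
        omega
      obtain ⟨k, -, hk⟩ := Finset.exists_lt_card_fiber_of_mul_lt_card_of_maps_to
        (t := Finset.range τ) (f := fun p => f (q (w p))) (n := n)
        (fun p hp => Finset.mem_range.2 (hf _ (hq _ (hwS p hp)))) (by simpa using hPcard)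
      set P' := P.filter fun p => f (q (w p)) = k with hP'
      have hP'P : ∀ p ∈ P', p ∈ P ∧ f (q (w p)) = k := fun p hp => Finset.mem_filter.1 hp
      have hwinj : Set.InjOn w P' := by
        intro p hp p' hp' h
        by_contra hne'
        exact hwpriv p' (hP'P p' hp').1 p (hP'P p hp).1 hne' (h ▸ hwadj p (hP'P p hp).1)
      have hex : ∀ i ∈ P'.image w, ∃ p ∈ P', w p = i := fun i hi => Finset.mem_image.1 hi
      choose! par hparP hparw using hex
      have hS1 : ∀ i ∈ P'.image w, i ∈ S ∧ G.Adj (par i) (q i) ∧ f (q i) = k ∧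
          ∀ p ∈ P, p ≠ par i → ¬ G.Adj p (q i) := by
        intro i hi
        have h1 := hP'P _ (hparP i hi)
        have h2 := hwS _ h1.1
        have h3 := hwadj _ h1.1
        have h4 := hwpriv _ h1.1
        rw [hparw i hi] at h2 h3 h4
        rw [hparw i hi] at h1
        exact ⟨h2, h3, h1.2, h4⟩
      have hparinj : Set.InjOn par (P'.image w : Finset ι) := by
        intro i hi j hj h
        rw [← hparw i hi, ← hparw j hj, h]
      obtain ⟨s, S', R, hS', hcard, ⟨a, hat, hsa⟩, hR⟩ := hn V G ι u (P'.image w) par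
        (ColorableOn.mono ⟨f, hf, hp⟩ (fun v hv => Near.mono hv (Nat.le_succ t)) le_rfl)
        hparinj (fun i hi => hPu _ (hP'P _ (hparP i hi)).1)
        (fun i hi j hj => by
          have := hq' i (hS1 i hi).1 (j + 1) (hj.trans (Near.of_adj (hS1 i hi).2.1))
          omega)
        (by rw [Finset.card_image_of_injOn hwinj]; exact hk.le)
      -- As `q j` is at distance `t + 1` from `u`, a vertex of an old leg adjacent to it must be at
      -- distance `t` from `u`. In `R i` only `par i` is that far, and `q j` is private to `par j`.
      have hnot : ∀ i ∈ S', ∀ j ∈ S', i ≠ j → ∀ x ∈ R i, x ≠ q j ∧ ¬ G.Adj x (q j) := by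
        intro i hi j hj hij x hx
        obtain ⟨a, b, hab, ha, hb⟩ := (hR i hi).2.2.2.2.1 x hx
        have hj' := hS1 j (hS' hj)
        constructor
        · rintro rfl
          have := hq' j hj'.1 a ha
          omega
        · intro hadj
          have := hq' j hj'.1 (a + 1) (ha.trans (Near.of_adj hadj))
          have hb0 : b = 0 := by omega
          subst hb0
          rw [near_zero hb] at hadj
          refine hj'.2.2.2 (par i) (hP'P _ (hparP i (hS' hi))).1 (fun h => hij ?_) hadj
          exact hparinj (hS' hi) (hS' hj) h
      refine ⟨s, S', fun i => insert (q i) (R i), fun i hi => (hS1 i (hS' hi)).1, hcard,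
        ⟨a, by omega, hsa⟩, ?_⟩
      intro i hi
      obtain ⟨h1, h2, ⟨r, hr, hsr⟩, h4, h5, h6⟩ := hR i hi
      obtain ⟨g1, g2, g3, g4⟩ := hS1 i (hS' hi)
      refine ⟨Or.inl rfl, connOn_insert h2 h1 g2, ⟨r, Or.inr hr, hsr⟩, ?_, ?_, ?_⟩
      · rintro (h | h)
        · have := hq' i g1 a (h ▸ hsa)
          omega
        · exact h4 h
      · rintro x (rfl | hx)
        · exact ⟨t + 1, 0, rfl, hq i g1, Near.refl _ _⟩
        · obtain ⟨a, b, hab, ha, hb⟩ := h5 x hx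
          exact ⟨a, b + 1, by omega, ha, hb.trans (Near.of_adj g2)⟩
      · rintro j hj hij x (rfl | hx) y (rfl | hy)
        · refine ⟨fun e => hij (hinj g1 (hS1 j (hS' hj)).1 e), fun e => ?_⟩
          exact hp _ (hq i g1) _ (hq j (hS1 j (hS' hj)).1) e
            (g3.trans (hS1 j (hS' hj)).2.2.1.symm)
        · exact ⟨(hnot j hj i hi hij.symm y hy).1.symm,
            fun e => (hnot j hj i hi hij.symm y hy).2 e.symm⟩
        · exact hnot i hi j hj hij x hx
        · exact h6 j hj hij x hx y hy

end Spiders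

/-! ### Splitting into subsets far apart. -/

section Splitting

universe u

/-- The distance in `G` from `Y` to `z` is `k`. -/
def DistEq {V : Type*} (G : SimpleGraph V) (Y : Set V) (k : ℕ) (z : V) : Prop :=
  (∃ y ∈ Y, Near G k y z) ∧ ∀ y ∈ Y, ∀ j, Near G j y z → k ≤ j

/-- Many connected sets pairwise far apart, all at the same distance from every vertex of a set of
large chromatic number, give an induced subdivision of `K_ν^1`. -/
theorem not_subdivisionFree_of_distEq (ν τ t : ℕ) (ht : 2 ≤ t) : ∃ n : ℕ,
    ∀ (V : Type u) (G : SimpleGraph V) (ι : Type) [Fintype ι] (Y : ι → Set V) (S : Finset ι)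
      (Z : Set V), (∀ v, ColorableOn G {u | Near G (2 * t + 1) v u} τ) →
      (∀ i ∈ S, ConnOn G (Y i)) →
      (∀ i ∈ S, ∀ j ∈ S, i ≠ j → ∀ a ∈ Y i, ∀ b ∈ Y j, ∀ l, Near G l a b → t + 1 ≤ l) →
      (∀ i ∈ S, ∀ z ∈ Z, DistEq G (Y i) (t + 1) z) → n ≤ S.card →
      ¬ ColorableOn G Z (Fintype.card (Finset ι) * (ν * τ)) →
      ¬ SubdivisionFree (subdividedComplete ν) G := by
  classical
  obtain ⟨n, hn⟩ := exists_spider.{u, 0} τ (Fintype.card (Sym2 (Fin ν))) t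
  refine ⟨n, fun V G ι _ Y S Z hτ hY hYY hZ hS hcol => ?_⟩
  -- The last vertex before `Y i` on a shortest path from `u`; it is at distance exactly `t` from
  -- `u`.
  have hq : ∀ u i, ∃ q, u ∈ Z → i ∈ S → Near G t u q ∧ ∃ y ∈ Y i, G.Adj q y := by
    intro u i
    by_cases h : u ∈ Z ∧ i ∈ S
    · obtain ⟨⟨y, hy, hyu⟩, hmin⟩ := hZ i h.2 u h.1
      rcases near_succ hyu.symm with h' | ⟨q, hq, hqy⟩
      · have := hmin y hy t h'.symm
        omega
      · exact ⟨q, fun _ _ => ⟨hq, y, hy, hqy⟩⟩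
    · exact ⟨u, fun h1 h2 => absurd ⟨h1, h2⟩ h⟩
  choose q hq using hq
  have hqmin : ∀ u ∈ Z, ∀ i ∈ S, ∀ j, Near G j u (q u i) → t ≤ j := by
    intro u hu i hi j hj
    obtain ⟨y, hy, hadj⟩ := (hq u i hu hi).2
    have := (hZ i hi u hu).2 y hy (j + 1) (hj.trans (Near.of_adj hadj)).symm
    omega
  -- A shared vertex would put two of the sets `Y i` within distance 2; this is excluded because `2
  -- ≤ t`.
  have hqinj : ∀ u ∈ Z, Set.InjOn (q u) S := by
    intro u hu i hi j hj h
    by_contra hij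
    obtain ⟨y, hy, hadj⟩ := (hq u i hu hi).2
    obtain ⟨y', hy', hadj'⟩ := (hq u j hu hj).2
    rw [← h] at hadj'
    have := hYY i hi j hj hij y hy y' hy' 2 ((Near.of_adj hadj.symm).trans (Near.of_adj hadj'))
    omega
  have hsp : ∀ u, ∃ (s : V) (S' : Finset ι) (R : ι → Set V), u ∈ Z → S' ⊆ S ∧
      S'.card = Fintype.card (Sym2 (Fin ν)) ∧ (∃ a < t, Near G a u s) ∧
      ∀ i ∈ S', q u i ∈ R i ∧ ConnOn G (R i) ∧ (∃ r ∈ R i, G.Adj s r) ∧ s ∉ R i ∧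
        (∀ x ∈ R i, ∃ a b, a + b = t ∧ Near G a u x ∧ Near G b x (q u i)) ∧
        ∀ j ∈ S', i ≠ j → Apart G (R i) (R j) := by
    intro u
    by_cases hu : u ∈ Z
    · obtain ⟨s, S', R, h⟩ := hn V G ι u S (q u)
        ((hτ u).mono (fun v hv => Near.mono hv (by omega)) le_rfl) (hqinj u hu)
        (fun i hi => (hq u i hu hi).1) (hqmin u hu) hS
      exact ⟨s, S', R, fun _ => h⟩
    · exact ⟨u, ∅, fun _ => ∅, fun h => absurd h hu⟩
  choose s S' R hsp using hsp
  -- The spiders must reach the same sets `Y i`, so the centres `u` are first sorted by the index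
  -- set of their spider; this costs the factor `Fintype.card (Finset ι)`.
  obtain ⟨S₀, hS₀⟩ := exists_fiber_not_colorableOn S' hcol
  obtain ⟨x, hx, hfar⟩ := exists_far_points hτ ν hS₀
  have hxZ : ∀ a, x a ∈ Z := fun a => (hx a).1
  have hxS : ∀ a, S' (x a) = S₀ := fun a => (hx a).2
  obtain ⟨u₀, hu₀⟩ := nonempty_of_not_colorableOn hS₀
  have hcard : S₀.card = Fintype.card (Sym2 (Fin ν)) := hu₀.2 ▸ (hsp u₀ hu₀.1).2.1
  have hsub : S₀ ⊆ S := hu₀.2 ▸ (hsp u₀ hu₀.1).1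
  obtain ⟨g⟩ : Nonempty (Sym2 (Fin ν) ≃ S₀) :=
    Fintype.card_eq.1 (by rw [Fintype.card_coe, hcard])
  have hgS : ∀ e, (g e : ι) ∈ S := fun e => hsub (g e).2
  have hgne : ∀ {e f}, e ≠ f → (g e : ι) ≠ g f := fun h h' => h (g.injective (Subtype.ext h'))
  have hsp' : ∀ a e, q (x a) (g e) ∈ R (x a) (g e) ∧ ConnOn G (R (x a) (g e)) ∧
      (∃ r ∈ R (x a) (g e), G.Adj (s (x a)) r) ∧ s (x a) ∉ R (x a) (g e) ∧
      (∀ z ∈ R (x a) (g e), ∃ c b, c + b = t ∧ Near G c (x a) z ∧ Near G b z (q (x a) (g e))) ∧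
      ∀ f, e ≠ f → Apart G (R (x a) (g e)) (R (x a) (g f)) := by
    intro a e
    obtain ⟨h1, h2, h3, h4, h5, h6⟩ := (hsp (x a) (hxZ a)).2.2.2 (g e) (by rw [hxS]; exact (g e).2)
    exact ⟨h1, h2, h3, h4, h5, fun f hef => h6 (g f) (by rw [hxS]; exact (g f).2) (hgne hef)⟩
  have hstep : ∀ {c d : V}, (c = d ∨ G.Adj c d) → Near G 1 c d := by
    rintro c d (rfl | h)
    exacts [Near.refl _ _, Near.of_adj h]
  have happ : ∀ A B : Set V, (∀ c ∈ A, ∀ d ∈ B, ¬ Near G 1 c d) → Apart G A B :=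
    fun A B h c hc d hd => ⟨fun e => h c hc d hd (hstep (Or.inl e)),
      fun e => h c hc d hd (hstep (Or.inr e))⟩
  refine not_subdivisionFree_of_grid (fun a => s (x a)) (fun e => Y (g e))
    (fun a e => R (x a) (g e)) (fun e => hY _ (hgS e)) ?_ (fun a e => (hsp' a e).2.1)
    (fun a e => (hsp' a e).2.2.1) ?_ ?_ ?_ (fun a e => (hsp' a e).2.2.2.2.2)
    (fun a e => (hsp' a e).2.2.2.1) ?_
  · intro e f hef
    refine happ _ _ fun c hc d hd h => ?_
    have := hYY _ (hgS e) _ (hgS f) (hgne hef) c hc d hd 1 h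
    omega
  · intro a e
    obtain ⟨y, hy, hadj⟩ := (hq (x a) (g e) (hxZ a) (hgS e)).2
    exact ⟨_, (hsp' a e).1, y, hy, hadj⟩
  · intro a e f hef
    refine happ _ _ fun z hz y hy h => ?_
    obtain ⟨c, b, hcb, hc, hb⟩ := (hsp' a e).2.2.2.2.1 z hz
    have h1 := (hZ _ (hgS f) (x a) (hxZ a)).2 y hy (c + 1) (hc.trans h).symm
    have hb0 : b = 0 := by omega
    subst hb0
    rw [near_zero hb] at h
    obtain ⟨y', hy', hadj⟩ := (hq (x a) (g e) (hxZ a) (hgS e)).2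
    have := hYY _ (hgS e) _ (hgS f) (hgne hef) y' hy' y hy 2 ((Near.of_adj hadj.symm).trans h)
    omega
  · intro a e
    refine happ _ _ fun z hz y hy h => ?_
    rw [Set.mem_singleton_iff] at hz
    subst hz
    obtain ⟨c, hc, hcs⟩ := (hsp (x a) (hxZ a)).2.2.1
    have := (hZ _ (hgS e) (x a) (hxZ a)).2 y hy (c + 1) (hcs.trans h).symm
    omega
  · intro a b hab e f
    have key : ∀ a e, ∀ z ∈ insert (s (x a)) (R (x a) (g e)), Near G t (x a) z := by
      rintro a e z (rfl | hz)
      · obtain ⟨c, hc, hcs⟩ := (hsp (x a) (hxZ a)).2.2.1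
        exact hcs.mono hc.le
      · obtain ⟨c, b, hcb, hc, -⟩ := (hsp' a e).2.2.2.2.1 z hz
        exact hc.mono (by omega)
    -- Each spider stays within distance `t` of its `x a`, so contact between two of them would give
    -- distance at most `t + 1 + t`, the radius in the hypothesis on balls.
    refine happ _ _ fun z hz y hy h => hfar a b hab ?_
    exact (((key a e z hz).trans h).trans (key b f y hy).symm).mono (by omega)

/-- A connected set whose second neighbourhood has chromatic number just above a given bound. -/
theorem exists_connOn_near {V : Type*} [Finite V] {G : SimpleGraph V} {τ c : ℕ}
    (hτ : ∀ v, ColorableOn G {u | Near G 2 v u} τ) {Z : Set V}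
    (hZ : ¬ ColorableOn G Z (2 * c)) :
    ∃ Y ⊆ Z, Y.Nonempty ∧ ConnOn G Y ∧ ¬ ColorableOn G {z ∈ Z | ∃ y ∈ Y, Near G 2 y z} c ∧
      ColorableOn G {z ∈ Z | ∃ y ∈ Y, Near G 2 y z} (c + τ) := by
  obtain ⟨z, hz, k, hk⟩ := exists_level hZ
  let F : Set (Set V) := {Y | z ∈ Y ∧ Y ⊆ Z ∧ ConnOn G Y ∧
    ColorableOn G {z ∈ Z | ∃ y ∈ Y, Near G 2 y z} (c + τ)}
  have hF : F.Nonempty := ⟨{z}, rfl, by simpa using hz, connOn_singleton z,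
    (hτ z).mono (by rintro v ⟨-, y, rfl, h⟩; exact h) (by omega)⟩
  obtain ⟨Y, ⟨hzY, hYZ, hY, hcol⟩, hmax⟩ := (Set.toFinite F).exists_maximal hF
  refine ⟨Y, hYZ, ⟨z, hzY⟩, hY, fun hc => hk ?_, hcol⟩
  -- Adding a vertex costs at most `τ` colours. If `c` colours still sufficed, the maximal `Y` would
  -- therefore contain the whole component of `z` in `Z`, including the level that is not
  -- `c`-colourable.
  have hclosed : ∀ x ∈ Y, ∀ x', (restrict G Z).Adj x x' → x' ∈ Y := by
    intro x hx x' hadj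
    refine hmax (y := insert x' Y) ⟨Or.inr hzY, Set.insert_subset hadj.2.2 hYZ,
      connOn_insert hY hx hadj.1, (hc.union (hτ x')).mono ?_ le_rfl⟩ (Set.subset_insert _ _)
      (Set.mem_insert _ _)
    rintro v ⟨hv, y, rfl | hy, h⟩
    · exact Or.inr h
    · exact Or.inl ⟨hv, y, hy, h⟩
  refine hc.mono ?_ le_rfl
  rintro x ⟨⟨p⟩, -⟩
  have hxY : x ∈ Y := by
    clear hk hmax hF F
    revert hzY
    clear hz
    induction p with
    | nil => exact fun h => h
    | cons e p ih => exact fun h => ih (hclosed _ h _ e)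
  exact ⟨hYZ hxY, x, hxY, Near.refl _ _⟩

/-- Any two subsets of `Z` of large chromatic number are at distance at most `D`. -/
def Unsplittable {V : Type*} (G : SimpleGraph V) (D c : ℕ) (Z : Set V) : Prop :=
  ∀ A ⊆ Z, ∀ B ⊆ Z, ¬ ColorableOn G A c → ¬ ColorableOn G B c → ∃ a ∈ A, ∃ b ∈ B, Near G D a b

/-- The second neighbourhood `A` of the set from `exists_connOn_near` uses at most `c + τ` colours
but more than `c`. Unsplittability then leaves at most `c` colours for the vertices further than `D`
from `A`. All remaining vertices have one of the `D` distances `3, …, D + 2` from `Y`. -/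
theorem Unsplittable.exists_distEq {V : Type*} [Finite V] {G : SimpleGraph V} {τ c D m : ℕ}
    (hτ : ∀ v, ColorableOn G {u | Near G 2 v u} τ) {Z : Set V} (hU : Unsplittable G D c Z)
    (hZ : ¬ ColorableOn G Z (2 * c + τ + D * m)) :
    ∃ Y ⊆ Z, Y.Nonempty ∧ ConnOn G Y ∧ ∃ k, 3 ≤ k ∧ k ≤ D + 2 ∧
      ¬ ColorableOn G {z ∈ Z | DistEq G Y k z} m := by
  classical
  obtain ⟨Y, hYZ, hne, hY, hA, hA'⟩ :=
    exists_connOn_near (c := c) hτ fun h => hZ (h.mono subset_rfl (by omega))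
  refine ⟨Y, hYZ, hne, hY, ?_⟩
  by_contra! hc
  set A := {z ∈ Z | ∃ y ∈ Y, Near G 2 y z} with hAdef
  have hB : ColorableOn G {z ∈ Z | ∀ a ∈ A, ¬ Near G D a z} c := by
    by_contra hB
    obtain ⟨a, ha, b, hb, hab⟩ := hU A (Set.sep_subset _ _) _ (Set.sep_subset _ _) hA hB
    exact hb.2 a ha hab
  have hL := colorableOn_biUnion (Finset.Icc 3 (D + 2)) (fun k => {z ∈ Z | DistEq G Y k z}) m
    (fun k hk => hc k (Finset.mem_Icc.1 hk).1 (Finset.mem_Icc.1 hk).2)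
  rw [Nat.card_Icc, show D + 2 + 1 - 3 = D by omega] at hL
  refine hZ (((hA'.union hB).union hL).mono ?_ (by omega))
  intro z hz
  by_cases h1 : z ∈ A
  · exact Or.inl (Or.inl h1)
  by_cases h2 : ∀ a ∈ A, ¬ Near G D a z
  · exact Or.inl (Or.inr ⟨hz, h2⟩)
  push Not at h2
  obtain ⟨a, ⟨-, y, hy, hya⟩, haz⟩ := h2
  have hex : ∃ j, ∃ y ∈ Y, Near G j y z := ⟨2 + D, y, hy, hya.trans haz⟩
  have hle : Nat.find hex ≤ 2 + D := Nat.find_min' hex ⟨y, hy, hya.trans haz⟩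
  have hge : 3 ≤ Nat.find hex := by
    by_contra hlt
    obtain ⟨y', hy', hn⟩ := Nat.find_spec hex
    exact h1 ⟨hz, y', hy', hn.mono (by omega)⟩
  refine Or.inr ?_
  simp only [Set.mem_iUnion]
  exact ⟨Nat.find hex, Finset.mem_Icc.2 ⟨hge, by omega⟩, hz, Nat.find_spec hex,
    fun y' hy' j hj => Nat.find_min' hex ⟨y', hy', hj⟩⟩

/-- Iterate `Unsplittable.exists_distEq` inside the level just found: the later connected sets lie
in that level, so their vertices have the prescribed distance from the earlier set. -/
theorem Unsplittable.exists_list (τ c D n m : ℕ) : ∃ c' : ℕ, ∀ (V : Type u) [Finite V]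
    (G : SimpleGraph V) (Z : Set V), (∀ v, ColorableOn G {u | Near G 2 v u} τ) →
    Unsplittable G D c Z → ¬ ColorableOn G Z c' →
    ∃ (l : List (Set V × ℕ)) (Z' : Set V), l.length = n ∧ Z' ⊆ Z ∧ ¬ ColorableOn G Z' m ∧
      (∀ p ∈ l, ConnOn G p.1 ∧ p.1 ⊆ Z ∧ 3 ≤ p.2 ∧ p.2 ≤ D + 2 ∧
        ∀ z ∈ Z', DistEq G p.1 p.2 z) ∧
      l.Pairwise fun p p' => ∀ y ∈ p'.1, DistEq G p.1 p.2 y := by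
  induction n with
  | zero => exact ⟨m, fun V _ G Z _ _ hZ => ⟨[], Z, rfl, subset_rfl, hZ, by simp, by simp⟩⟩
  | succ n ih =>
    obtain ⟨c', hc'⟩ := ih
    refine ⟨2 * c + τ + D * c', fun V _ G Z hτ hU hZ => ?_⟩
    obtain ⟨Y, hYZ, -, hY, k, hk3, hkD, hk⟩ := hU.exists_distEq hτ hZ
    obtain ⟨l, Z', hl, hZ', hcol, hprop, hpair⟩ := hc' V G {z ∈ Z | DistEq G Y k z} hτ
      (fun A hA B hB => hU A (hA.trans (Set.sep_subset _ _)) B (hB.trans (Set.sep_subset _ _))) hk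
    refine ⟨(Y, k) :: l, Z', by simp [hl], hZ'.trans (Set.sep_subset _ _), hcol, ?_, ?_⟩
    · intro p hp
      rcases List.mem_cons.1 hp with rfl | hp
      · exact ⟨hY, hYZ, hk3, hkD, fun z hz => (hZ' hz).2⟩
      · obtain ⟨h1, h2, h3⟩ := hprop p hp
        exact ⟨h1, h2.trans (Set.sep_subset _ _), h3⟩
    · exact List.pairwise_cons.2 ⟨fun p hp y hy => ((hprop p hp).2.1 hy).2, hpair⟩

/-- In a `K_ν^1`-subdivision-free graph with small balls, a set of large chromatic number has two
subsets of large chromatic number that are far apart. -/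
theorem exists_split (ν τ D c : ℕ) : ∃ c' : ℕ, ∀ (V : Type u) [Finite V] (G : SimpleGraph V)
    (Z : Set V), (∀ v, ColorableOn G {u | Near G (2 * D + 3) v u} τ) →
    SubdivisionFree (subdividedComplete ν) G → ¬ ColorableOn G Z c' → ¬ Unsplittable G D c Z := by
  classical
  have hex : ∀ t, ∃ n : ℕ, 2 ≤ t → ∀ (V : Type u) (G : SimpleGraph V) (ι : Type) [Fintype ι]
      (Y : ι → Set V) (S : Finset ι)
      (Z : Set V), (∀ v, ColorableOn G {u | Near G (2 * t + 1) v u} τ) →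
      (∀ i ∈ S, ConnOn G (Y i)) →
      (∀ i ∈ S, ∀ j ∈ S, i ≠ j → ∀ a ∈ Y i, ∀ b ∈ Y j, ∀ l, Near G l a b → t + 1 ≤ l) →
      (∀ i ∈ S, ∀ z ∈ Z, DistEq G (Y i) (t + 1) z) → n ≤ S.card →
      ¬ ColorableOn G Z (Fintype.card (Finset ι) * (ν * τ)) →
      ¬ SubdivisionFree (subdividedComplete ν) G := by
    intro t
    by_cases ht : 2 ≤ t
    · obtain ⟨n, hn⟩ := not_subdivisionFree_of_distEq.{u} ν τ t ht
      exact ⟨n, fun _ => hn⟩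
    · exact ⟨0, fun h => absurd h ht⟩
  choose n hn using hex
  -- There are `D` possible distances `t + 1` in `3, …, D + 2`, so `D * N + 1` sets give more than
  -- `N` with the same one, and `N` is enough for every `t ≤ D + 1`.
  let N := (Finset.range (D + 2)).sup n
  obtain ⟨c', hc'⟩ := Unsplittable.exists_list.{u} τ c D (D * N + 1)
    (Fintype.card (Finset (Fin (D * N + 1))) * (ν * τ))
  refine ⟨c', fun V _ G Z hτ hfree hZ hU => ?_⟩
  obtain ⟨l, Z', hl, -, hcol, hprop, hpair⟩ := hc' V G Z
    (fun v => (hτ v).mono (fun u hu => Near.mono hu (by omega)) le_rfl) hU hZ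
  rw [← hl] at hcol
  obtain ⟨k, hk, hlt⟩ := Finset.exists_lt_card_fiber_of_mul_lt_card_of_maps_to
    (s := (Finset.univ : Finset (Fin l.length))) (t := Finset.Icc 3 (D + 2))
    (f := fun i => (l.get i).2) (n := N)
    (fun i _ => Finset.mem_Icc.2 ⟨(hprop _ (l.get_mem i)).2.2.1, (hprop _ (l.get_mem i)).2.2.2.1⟩)
    (by
      rw [Nat.card_Icc, show D + 2 + 1 - 3 = D by omega, Finset.card_univ, Fintype.card_fin, hl]
      exact Nat.lt_succ_self _)
  obtain ⟨hk3, hkD⟩ := Finset.mem_Icc.1 hk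
  obtain ⟨t, rfl⟩ : ∃ t, k = t + 1 := ⟨k - 1, by omega⟩
  have hmem : ∀ i ∈ Finset.univ.filter fun i : Fin l.length => (l.get i).2 = t + 1,
      (l.get i).2 = t + 1 := fun i hi => (Finset.mem_filter.1 hi).2
  refine hn t (by omega) V G (Fin l.length) (fun i => (l.get i).1)
    (Finset.univ.filter fun i => (l.get i).2 = t + 1) Z'
    (fun v => (hτ v).mono (fun u hu => Near.mono hu (by omega)) le_rfl)
    (fun i _ => (hprop _ (l.get_mem i)).1) ?_ ?_
    (le_trans (Finset.le_sup (f := n) (Finset.mem_range.2 (by omega))) hlt.le) hcol hfree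
  · intro i hi j hj hij a ha b hb r hr
    rw [List.pairwise_iff_get] at hpair
    rcases lt_or_gt_of_ne hij with h | h
    · have := (hpair i j h b hb).2 a ha r hr
      rwa [hmem i hi] at this
    · have := (hpair j i h a ha).2 b hb r hr.symm
      rwa [hmem j hj] at this
  · intro i hi z hz
    have := (hprop _ (l.get_mem i)).2.2.2.2 z hz
    rwa [hmem i hi] at this

/-- Many pairwise far apart subsets of large chromatic number. -/
theorem exists_many_split {J : Type*} (ν τ D : ℕ) (s : Finset J) (c : ℕ) : ∃ c' : ℕ,
    ∀ (V : Type u) [Finite V] (G : SimpleGraph V)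
    (Z : Set V), (∀ v, ColorableOn G {u | Near G (2 * D + 3) v u} τ) →
    SubdivisionFree (subdividedComplete ν) G → ¬ ColorableOn G Z c' →
    ∃ A : J → Set V, (∀ i ∈ s, A i ⊆ Z ∧ ¬ ColorableOn G (A i) c) ∧
      ∀ i ∈ s, ∀ j ∈ s, i ≠ j → ∀ a ∈ A i, ∀ b ∈ A j, ¬ Near G D a b := by
  classical
  induction s using Finset.induction_on with
  | empty => exact ⟨0, fun V _ G Z _ _ _ => ⟨fun _ => ∅, by simp, by simp⟩⟩
  | insert i₀ s hi₀ ih =>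
    obtain ⟨c₁, hc₁⟩ := ih
    -- One half of the split becomes the new set, needing `c`; the other is split further, needing
    -- `c₁`.
    obtain ⟨c₂, hc₂⟩ := exists_split.{u} ν τ D (max c c₁)
    refine ⟨c₂, fun V _ G Z hτ hfree hZ => ?_⟩
    have hU := hc₂ V G Z hτ hfree hZ
    simp only [Unsplittable, not_forall, not_exists, not_and] at hU
    obtain ⟨P, hP, Q, hQ, hP', hQ', hPQ⟩ := hU
    obtain ⟨A, hA, hfar⟩ := hc₁ V G Q hτ hfree fun h => hQ' (h.mono subset_rfl (le_max_right _ _))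
    have hne : ∀ i ∈ s, i ≠ i₀ := fun i hi h => hi₀ (h ▸ hi)
    refine ⟨Function.update A i₀ P, ?_, ?_⟩
    · intro i hi
      rcases Finset.mem_insert.1 hi with rfl | hi
      · rw [Function.update_self]
        exact ⟨hP, fun h => hP' (h.mono subset_rfl (le_max_left _ _))⟩
      · rw [Function.update_of_ne (hne i hi)]
        exact ⟨(hA i hi).1.trans hQ, (hA i hi).2⟩
    · intro i hi j hj hij a ha b hb hn
      rcases Finset.mem_insert.1 hi with rfl | hi' <;> rcases Finset.mem_insert.1 hj with rfl | hj'
      · exact hij rfl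
      · rw [Function.update_self] at ha
        rw [Function.update_of_ne (hne j hj')] at hb
        exact hPQ a ha b ((hA j hj').1 hb) hn
      · rw [Function.update_self] at hb
        rw [Function.update_of_ne (hne i hi')] at ha
        exact hPQ b hb a ((hA i hi').1 ha) hn.symm
      · rw [Function.update_of_ne (hne i hi')] at ha
        rw [Function.update_of_ne (hne j hj')] at hb
        exact hfar i hi' j hj' hij a ha b hb hn

end Splitting

/-! ### Levelled pineapples from breadth-first search. -/

section Levelled

variable {V : Type*} {G : SimpleGraph V}

theorem IsLevelledPineapple.mono {X X' Y : Set V} (h : IsLevelledPineapple G X Y) (hX : X' ⊆ X) :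
    IsLevelledPineapple G X' Y := by
  obtain ⟨⟨⟨hd, hc⟩, hconn⟩, z, hz, k, h1, h2⟩ := h
  refine ⟨⟨⟨hd.mono_left hX, fun x hx => hc x (hX hx)⟩, hconn⟩, z, hz, k, h1, ?_⟩
  rintro x hx ⟨p, hp, hs, hk⟩
  exact h2 x (hX hx) ⟨p, hp, fun w hw => (hs w hw).imp_left fun h => hX h, hk⟩

/-- Let `C` be a level, inside `Z`, that is not `n`-colourable, `X` the level before it, and `Y` all
earlier levels. The bound `τ + 1 ≤ n` rules out levels 0 and 1 for `C`, so `Y` contains the root. -/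
theorem exists_levelledPineapple {τ n : ℕ} (hτ : ∀ v, ColorableOn G {u | Near G 1 v u} τ)
    (hn : τ + 1 ≤ n) {Z : Set V} (hZ : ¬ ColorableOn G Z (2 * n)) :
    ∃ X Y C : Set V, IsLevelledPineapple G X Y ∧ X ∪ Y ⊆ Z ∧ C ⊆ Z ∧ ¬ ColorableOn G C n ∧
      Disjoint (X ∪ Y) C ∧ NoEdges G C Y ∧ Covers G X C := by
  obtain ⟨z, hz, k, hk⟩ := exists_level hZ
  set H := restrict G Z with hH
  have hHZ : ∀ {x}, H.Reachable z x → x ∈ Z := fun h => mem_of_restrict_reachable h hz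
  have hdist : ∀ {x j}, Near H j z x → H.dist z x ≤ j := by
    rintro x j ⟨p, hp⟩
    exact (dist_le p).trans hp
  have hdown : ∀ i x, H.Reachable z x → H.dist z x = i + 1 →
      ∃ c, H.Reachable z c ∧ H.dist z c = i ∧ H.Adj c x := by
    intro i x hr hx
    obtain ⟨p, hp⟩ := hr.exists_walk_length_eq_dist
    rcases near_succ (⟨p, by omega⟩ : Near H (i + 1) z x) with h | ⟨c, hc, hadj⟩
    · have := hdist h
      omega
    · have h1 := hdist hc
      have hrc : H.Reachable z c := ⟨hc.choose⟩
      have h2 := hrc.dist_triangle_left x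
      rw [dist_eq_one_iff_adj.2 hadj] at h2
      exact ⟨c, hrc, by omega, hadj⟩
  obtain ⟨j, rfl⟩ : ∃ j, k = j + 2 := by
    rcases k with _ | _ | j
    · refine absurd ((colorableOn_singleton z).mono ?_ (by omega)) hk
      rintro x ⟨hr, hx⟩
      exact (hr.dist_eq_zero_iff.1 hx).symm
    · refine absurd ((hτ z).mono ?_ (by omega)) hk
      rintro x ⟨hr, hx⟩
      have hadj : H.Adj z x := dist_eq_one_iff_adj.1 (by simpa using hx)
      exact Near.of_adj hadj.1
    · exact ⟨j, rfl⟩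
  set Y := {x | H.Reachable z x ∧ H.dist z x ≤ j} with hY
  have hYZ : Y ⊆ Z := fun x hx => hHZ hx.1
  have hzY : z ∈ Y := ⟨Reachable.rfl, by simp⟩
  have hin : ∀ i ≤ j, ∀ x, H.Reachable z x → H.dist z x = i → Near (restrict G Y) i z x := by
    intro i
    induction i with
    | zero =>
      intro _ x hr hx
      rw [hr.dist_eq_zero_iff.1 hx]
      exact Near.refl _ _
    | succ i ih =>
      intro hi x hr hx
      obtain ⟨c, hrc, hc, hadj⟩ := hdown i x hr hx
      exact (ih (by omega) c hrc hc).trans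
        (Near.of_adj ⟨hadj.1, ⟨hrc, by omega⟩, ⟨hr, by omega⟩⟩)
  have hconn : ConnOn G Y := by
    have : ∀ x ∈ Y, (restrict G Y).Reachable z x := fun x hx =>
      ⟨(hin _ hx.2 x hx.1 rfl).choose⟩
    exact fun a ha b hb => (this a ha).symm.trans (this b hb)
  refine ⟨{x | H.Reachable z x ∧ H.dist z x = j + 1}, Y,
    {x | H.Reachable z x ∧ H.dist z x = j + 2}, ⟨⟨⟨?_, ?_⟩, hconn.induce_connected ⟨z, hzY⟩⟩,
      z, hzY, j + 1, ?_, ?_⟩, ?_, fun x hx => hHZ hx.1, hk, ?_, ?_, ?_, ?_⟩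
  · rw [Set.disjoint_left]
    rintro x ⟨-, h1⟩ ⟨-, h2⟩
    omega
  · rintro x ⟨hr, hx⟩
    obtain ⟨c, hrc, hc, hadj⟩ := hdown j x hr hx
    exact ⟨c, ⟨hrc, hc.le⟩, hadj.1.symm⟩
  · classical
    intro y hy
    obtain ⟨p, hp⟩ := (hin _ hy.2 y hy.1 rfl).symm
    refine ⟨p.bypass.mapLe (restrict_le Y), ?_, ?_, ?_⟩
    · simpa using p.bypass_isPath
    · rw [Walk.support_mapLe_eq_support]
      exact support_subset_of_restrict _ hy
    · have h1 := p.length_bypass_le_length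
      have h2 := hy.2
      have h3 : (p.bypass.mapLe (restrict_le Y)).length = p.bypass.length := Walk.length_map _ _
      omega
  · rintro x ⟨hr, hx⟩ ⟨p, -, hp, hlt⟩
    obtain ⟨q, hq⟩ := exists_restrict_walk (W := Z) p fun w hw =>
      (hp w hw).elim (fun h => hHZ h.1) (fun h => hHZ h.1)
    have : H.dist z x ≤ q.length := dist_le q
    omega
  · rintro x (h | h) <;> exact hHZ h.1
  · rw [Set.disjoint_left]
    rintro x (⟨-, h1⟩ | ⟨-, h1⟩) ⟨-, h2⟩ <;> omega
  · rintro c ⟨hrc, hc⟩ y ⟨hry, hy⟩ hadj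
    have h1 := hry.dist_triangle_left c
    rw [dist_eq_one_iff_adj.2 (show H.Adj y c from ⟨hadj.symm, hHZ hry, hHZ hrc⟩)] at h1
    omega
  · rw [Set.disjoint_left]
    rintro x ⟨-, h1⟩ ⟨-, h2⟩
    omega
  · rintro x ⟨hr, hx⟩
    obtain ⟨c, hrc, hc, hadj⟩ := hdown (j + 1) x hr hx
    exact ⟨c, ⟨hrc, hc⟩, hadj.1.symm⟩

/-- A sequence of levelled pineapples, each lying outside the closed neighbourhoods of the connected
parts of the earlier ones, with a set `Z` below all of them. -/
def Nested (G : SimpleGraph V) (anc : List (Set V × Set V)) (Z : Set V) : Prop :=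
  anc.Pairwise (fun a b => Disjoint (a.1 ∪ a.2) (b.1 ∪ b.2) ∧ NoEdges G (b.1 ∪ b.2) a.2) ∧
  ∀ a ∈ anc, IsLevelledPineapple G a.1 a.2 ∧ Disjoint (a.1 ∪ a.2) Z ∧ NoEdges G Z a.2 ∧
    Covers G a.1 Z

theorem NoEdges.mono_left {A A' B : Set V} (h : NoEdges G A B) (hA : A' ⊆ A) : NoEdges G A' B :=
  fun a ha => h a (hA ha)

theorem Covers.mono {X Y Y' : Set V} (h : Covers G X Y) (hY : Y' ⊆ Y) : Covers G X Y' :=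
  ⟨h.1.mono_left hY, fun y hy => h.2 y (hY hy)⟩

theorem Nested.mono {anc : List (Set V × Set V)} {Z Z' : Set V} (h : Nested G anc Z)
    (hZ : Z' ⊆ Z) : Nested G anc Z' :=
  ⟨h.1, fun a ha => ⟨(h.2 a ha).1, (h.2 a ha).2.1.mono_right hZ, (h.2 a ha).2.2.1.mono_left hZ,
    (h.2 a ha).2.2.2.mono hZ⟩⟩

theorem Nested.sublist {anc anc' : List (Set V × Set V)} {Z : Set V} (h : Nested G anc Z)
    (hs : anc'.Sublist anc) : Nested G anc' Z :=
  ⟨h.1.sublist hs, fun a ha => h.2 a (hs.subset ha)⟩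

theorem Nested.concat {anc : List (Set V × Set V)} {Z X Y C : Set V} (h : Nested G anc Z)
    (hXY : IsLevelledPineapple G X Y) (hZ : X ∪ Y ⊆ Z) (hC : C ⊆ Z) (hd : Disjoint (X ∪ Y) C)
    (hn : NoEdges G C Y) (hc : Covers G X C) : Nested G (anc ++ [(X, Y)]) C := by
  refine ⟨?_, ?_⟩
  · rw [List.pairwise_append]
    refine ⟨h.1, List.pairwise_singleton _ _, ?_⟩
    intro a ha b hb
    rw [List.mem_singleton] at hb
    subst hb
    exact ⟨(h.2 a ha).2.1.mono_right hZ, (h.2 a ha).2.2.1.mono_left hZ⟩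
  · intro a ha
    rcases List.mem_append.1 ha with ha | ha
    · exact (h.mono hC).2 a ha
    · rw [List.mem_singleton] at ha
      subst ha
      exact ⟨hXY, hd, hn, hc⟩

end Levelled

/-! ### Ramsey's theorem for ordered lists. -/

section Ramsey

/-- The usual induction on the head of the list. Sublists keep the order, so `R` need not be
symmetric; this matters for `Good`. -/
theorem exists_ramsey_list (m n : ℕ) : ∃ r : ℕ, ∀ {α : Type*} (R : α → α → Prop) (l : List α),
    r ≤ l.length → (∃ l' : List α, l'.Sublist l ∧ l'.length = m ∧ l'.Pairwise R) ∨
      ∃ l' : List α, l'.Sublist l ∧ l'.length = n ∧ l'.Pairwise fun a b => ¬ R a b := by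
  classical
  induction m generalizing n with
  | zero => exact ⟨0, fun R l _ => Or.inl ⟨[], List.nil_sublist l, rfl, List.Pairwise.nil⟩⟩
  | succ m ihm =>
    induction n with
    | zero => exact ⟨0, fun R l _ => Or.inr ⟨[], List.nil_sublist l, rfl, List.Pairwise.nil⟩⟩
    | succ n ihn =>
      obtain ⟨r₁, h₁⟩ := ihm (n + 1)
      obtain ⟨r₂, h₂⟩ := ihn
      refine ⟨r₁ + r₂ + 1, fun R l hl => ?_⟩
      cases l with
      | nil => simp at hl
      | cons a l =>
        have hlen := List.length_eq_length_filter_add (l := l) fun b => decide (R a b)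
        rw [List.length_cons] at hl
        rcases (by omega : r₁ ≤ (l.filter fun b => decide (R a b)).length ∨
          r₂ ≤ (l.filter fun b => !decide (R a b)).length) with h | h
        · rcases h₁ R _ h with ⟨l', hs, hl', hp⟩ | ⟨l', hs, hl', hp⟩
          · refine Or.inl ⟨a :: l', (hs.trans List.filter_sublist).cons_cons a, by simp [hl'],
              List.pairwise_cons.2 ⟨fun b hb => ?_, hp⟩⟩
            simpa using (List.mem_filter.1 (hs.subset hb)).2
          · exact Or.inr ⟨l', (hs.trans List.filter_sublist).cons a, hl', hp⟩
        · rcases h₂ R _ h with ⟨l', hs, hl', hp⟩ | ⟨l', hs, hl', hp⟩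
          · exact Or.inl ⟨l', (hs.trans List.filter_sublist).cons a, hl', hp⟩
          · refine Or.inr ⟨a :: l', (hs.trans List.filter_sublist).cons_cons a, by simp [hl'],
              List.pairwise_cons.2 ⟨fun b hb => ?_, hp⟩⟩
            simpa using (List.mem_filter.1 (hs.subset hb)).2

/-- The sublist of the entries marked `true`. -/
def select {α : Type*} : List Bool → List α → List α
  | true :: m, a :: l => a :: select m l
  | false :: m, _ :: l => select m l
  | _, _ => []

/-- A mask does not mention the entries, so for a fixed length there are finitely many and they can
serve as colours. -/
theorem exists_select_of_sublist {α : Type*} {l l' : List α} (h : l'.Sublist l) :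
    ∃ m : List Bool, m.length = l.length ∧ select m l = l' := by
  induction h with
  | slnil => exact ⟨[], rfl, rfl⟩
  | cons a _ ih =>
    obtain ⟨m, hm, rfl⟩ := ih
    exact ⟨false :: m, by simp [hm], rfl⟩
  | cons_cons a _ ih =>
    obtain ⟨m, hm, rfl⟩ := ih
    exact ⟨true :: m, by simp [hm], rfl⟩

theorem select_sublist {α : Type*} (m : List Bool) (l : List α) : (select m l).Sublist l := by
  induction m generalizing l with
  | nil => simp [select]
  | cons b m ih =>
    cases l with
    | nil => cases b <;> simp [select]
    | cons a l =>
      cases b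
      · exact (ih l).cons a
      · exact (ih l).cons_cons a

theorem length_select {α : Type*} (m : List Bool) (l : List α) (h : m.length = l.length) :
    (select m l).length = m.count true := by
  induction m generalizing l with
  | nil => simp [select]
  | cons b m ih =>
    cases l with
    | nil => simp at h
    | cons a l =>
      have := ih l (by simpa using h)
      cases b <;> simp [select, this]

end Ramsey

/-! ### Complete trees of nested pineapples. -/

section Systems

universe u

/-- A system of depth `n` below the pineapples of `anc`: a complete `I`-ary tree of levelled
pineapples in `Z`, with the sets in different branches far apart, and with the property `P` at its
leaves. -/
def HasSystem {V : Type*} (I : Type*) (G : SimpleGraph V) (D : ℕ)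
    (P : List (Set V × Set V) → Set V → Prop) : ℕ → List (Set V × Set V) → Set V → Prop
  | 0, anc, Z => ∃ Z' ⊆ Z, P anc Z'
  | n + 1, anc, Z => ∃ (X Y : Set V) (A : I → Set V), IsLevelledPineapple G X Y ∧ X ∪ Y ⊆ Z ∧
      (∀ i, A i ⊆ Z ∧ Disjoint (X ∪ Y) (A i) ∧ NoEdges G (A i) Y ∧ Covers G X (A i)) ∧
      (∀ i j, i ≠ j → ∀ a ∈ A i, ∀ b ∈ A j, ¬ Near G D a b) ∧
      ∀ i, HasSystem I G D P n (anc ++ [(X, Y)]) (A i)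

variable {V : Type*} {I : Type*} {G : SimpleGraph V} {D : ℕ}
  {P P' : List (Set V × Set V) → Set V → Prop}

theorem HasSystem.mono {n : ℕ} {anc : List (Set V × Set V)} {Z Z' : Set V}
    (h : HasSystem I G D P n anc Z) (hZ : Z ⊆ Z') : HasSystem I G D P n anc Z' := by
  cases n with
  | zero =>
    obtain ⟨W, hW, hP⟩ := h
    exact ⟨W, hW.trans hZ, hP⟩
  | succ n =>
    obtain ⟨X, Y, A, h1, h2, h3, h4⟩ := h
    exact ⟨X, Y, A, h1, h2.trans hZ, fun i => ⟨(h3 i).1.trans hZ, (h3 i).2⟩, h4⟩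

theorem HasSystem.exists_leaf [Nonempty I] {n : ℕ} {anc : List (Set V × Set V)} {Z : Set V}
    (h : HasSystem I G D P n anc Z) :
    ∃ (suf : List (Set V × Set V)) (Z' : Set V), suf.length = n ∧ P (anc ++ suf) Z' := by
  induction n generalizing anc Z with
  | zero =>
    obtain ⟨W, hW, hP⟩ := h
    exact ⟨[], W, rfl, by simpa using hP⟩
  | succ n ih =>
    obtain ⟨X, Y, A, h1, h2, h3, h4, h5⟩ := h
    obtain ⟨suf, Z', hs, hP⟩ := ih (h5 (Classical.arbitrary I))
    exact ⟨(X, Y) :: suf, Z', by simp [hs], by simpa using hP⟩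

/-- Forgetting some of the levels of a system. -/
theorem HasSystem.thin [Nonempty I] (mask : List Bool) {n : ℕ} (hn : mask.length = n)
    {anc anc' : List (Set V × Set V)} {Z : Set V}
    (hP : ∀ suf Z, suf.length = mask.length → P (anc ++ suf) Z → P' (anc' ++ select mask suf) Z)
    (h : HasSystem I G D P n anc Z) :
    HasSystem I G D P' (mask.count true) anc' Z := by
  subst hn
  induction mask generalizing anc anc' Z with
  | nil =>
    obtain ⟨W, hW, hPW⟩ := h
    exact ⟨W, hW, by simpa [select] using hP [] W rfl (by simpa using hPW)⟩
  | cons b mask ih =>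
    obtain ⟨X, Y, A, h1, h2, h3, h4, h5⟩ := h
    cases b with
    | false =>
      rw [List.count_cons_of_ne (by simp)]
      -- To forget a level, drop its pineapple and keep a single one of its branches.
      refine (ih (fun suf Z' hs hPs => ?_) (h5 (Classical.arbitrary I))).mono (h3 _).1
      exact hP ((X, Y) :: suf) Z' (by simp [hs]) (by simpa using hPs)
    | true =>
      rw [List.count_cons_self]
      refine ⟨X, Y, A, h1, h2, h3, h4, fun i => ih (fun suf Z' hs hPs => ?_) (h5 i)⟩
      have := hP ((X, Y) :: suf) Z' (by simp [hs]) (by simpa using hPs)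
      simpa [select] using this

/-- The colour of a vertex may depend on all pineapples above it, yet one colour serves every leaf:
splitting each covered set into `|K| * |I|` parts leaves `|I|` branches that agree on it. -/
theorem exists_hasSystem (I : Type*) [Fintype I] (K : Type*) [Fintype K] (ν τ D c n : ℕ) :
    ∃ c' : ℕ, ∀ (V : Type u) [Finite V] (G : SimpleGraph V) (κ : List (Set V × Set V) → V → K)
      (anc : List (Set V × Set V)) (Z : Set V),
      (∀ v, ColorableOn G {u | Near G (2 * D + 3) v u} τ) →
      SubdivisionFree (subdividedComplete ν) G → Nested G anc Z → ¬ ColorableOn G Z c' →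
      ∃ k, HasSystem I G D
        (fun anc Z => Nested G anc Z ∧ ¬ ColorableOn G Z c ∧ ∀ u ∈ Z, κ anc u = k) n anc Z := by
  classical
  induction n with
  | zero =>
    refine ⟨Fintype.card K * c, fun V _ G κ anc Z _ _ hN hZ => ?_⟩
    obtain ⟨k, hk⟩ := exists_fiber_not_colorableOn (κ anc) hZ
    exact ⟨k, _, Set.sep_subset _ _, hN.mono (Set.sep_subset _ _), hk, fun u hu => hu.2⟩
  | succ n ih =>
    obtain ⟨c₁, hc₁⟩ := ih
    obtain ⟨c₂, hc₂⟩ := exists_many_split.{u} ν τ D (Finset.univ : Finset (K × I)) c₁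
    refine ⟨2 * max c₂ (τ + 1), fun V _ G κ anc Z hτ hfree hN hZ => ?_⟩
    obtain ⟨X, Y, C, hXY, hXYZ, hCZ, hC, hd, hn, hc⟩ := exists_levelledPineapple
      (fun v => (hτ v).mono (fun u hu => Near.mono hu (by omega)) le_rfl) (le_max_right _ _) hZ
    obtain ⟨A, hA, hfar⟩ := hc₂ V G C hτ hfree fun h => hC (h.mono subset_rfl (le_max_left _ _))
    choose k hk using fun p : K × I => hc₁ V G κ (anc ++ [(X, Y)]) (A p) hτ hfree
      ((hN.concat hXY hXYZ hCZ hd hn hc).mono (hA p (Finset.mem_univ _)).1)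
      (hA p (Finset.mem_univ _)).2
    obtain ⟨z, -⟩ := nonempty_of_not_colorableOn hZ
    have : Nonempty K := ⟨κ [] z⟩
    obtain ⟨k₀, hk₀⟩ := Fintype.exists_le_card_fiber_of_mul_le_card k (n := Fintype.card I)
      (by rw [Fintype.card_prod])
    obtain ⟨g⟩ : Nonempty (I ↪ (Finset.univ.filter fun p => k p = k₀ : Finset (K × I))) :=
      Function.Embedding.nonempty_of_card_le (by rwa [Fintype.card_coe])
    have hg : ∀ i, k (g i) = k₀ := fun i => (Finset.mem_filter.1 (g i).2).2
    refine ⟨k₀, X, Y, fun i => A (g i), hXY, hXYZ, fun i => ?_, fun i j hij => ?_, fun i => ?_⟩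
    · have h := (hA (g i) (Finset.mem_univ _)).1
      exact ⟨h.trans hCZ, hd.mono_right h, hn.mono_left h, hc.mono h⟩
    · exact hfar _ (Finset.mem_univ _) _ (Finset.mem_univ _) fun h =>
        hij (g.injective (Subtype.ext h))
    · have := hk (g i)
      rwa [hg i] at this

end Systems

/-! ### Making the branches good. -/

section Picks

universe u

variable {V : Type*} {G : SimpleGraph V}

open Classical in
/-- A chosen neighbour of `u` in `X`, if there is one. -/
noncomputable def pick (G : SimpleGraph V) (X : Set V) (u : V) : V :=
  if h : ∃ x ∈ X, G.Adj u x then h.choose else u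

theorem pick_spec {X : Set V} {u : V} (h : ∃ x ∈ X, G.Adj u x) :
    pick G X u ∈ X ∧ G.Adj u (pick G X u) := by
  unfold pick
  rw [dif_pos h]
  exact h.choose_spec

/-- The chosen neighbour of `u` in the first pineapple has a neighbour in the second one. -/
def Good (G : SimpleGraph V) (u : V) (a b : Set V × Set V) : Prop :=
  ∃ y ∈ b.2, G.Adj (pick G a.1 u) y

/-- The chosen neighbours of `u` in two pineapples are nonadjacent, and the first has no neighbour
in the connected part of the second. -/
def Bad (G : SimpleGraph V) (u : V) (a b : Set V × Set V) : Prop :=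
  ¬ Good G u a b ∧ ¬ G.Adj (pick G a.1 u) (pick G b.1 u)

/-- The grid obstruction with the `Y`-parts as connected sets and, as spiders, stars formed by
scattered vertices `x a` and their picks. `Bad` keeps a pick away from later `Y`-parts, and nesting
keeps it away from earlier ones. -/
theorem not_subdivisionFree_of_bad {ν τ : ℕ} (hτ : ∀ v, ColorableOn G {u | Near G 3 v u} τ)
    {l : List (Set V × Set V)} {Z : Set V} (hN : Nested G l Z)
    (hl : l.length = Fintype.card (Sym2 (Fin ν))) (hbad : ∀ u ∈ Z, l.Pairwise (Bad G u))
    (hZ : ¬ ColorableOn G Z (ν * τ)) : ¬ SubdivisionFree (subdividedComplete ν) G := by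
  obtain ⟨x, hx, hfar⟩ := exists_far_points hτ ν hZ
  obtain ⟨g⟩ : Nonempty (Sym2 (Fin ν) ≃ Fin l.length) :=
    Fintype.card_eq.1 (by rw [Fintype.card_fin, hl])
  have hmem : ∀ e, l.get (g e) ∈ l := fun e => l.get_mem _
  have hpick : ∀ a e, pick G (l.get (g e)).1 (x a) ∈ (l.get (g e)).1 ∧
      G.Adj (x a) (pick G (l.get (g e)).1 (x a)) := fun a e =>
    pick_spec ((hN.2 _ (hmem e)).2.2.2.2 _ (hx a))
  have hpair := List.pairwise_iff_get.1 hN.1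
  have hbad' := fun a => List.pairwise_iff_get.1 (hbad (x a) (hx a))
  have hcase : ∀ {e f}, e ≠ f → g e < g f ∨ g f < g e := fun h =>
    lt_or_gt_of_ne fun h' => h (g.injective h')
  have hdisj : ∀ e f, e ≠ f →
      Disjoint ((l.get (g e)).1 ∪ (l.get (g e)).2) ((l.get (g f)).1 ∪ (l.get (g f)).2) := by
    intro e f hef
    rcases hcase hef with h | h
    exacts [(hpair _ _ h).1, (hpair _ _ h).1.symm]
  refine not_subdivisionFree_of_grid x (fun e => (l.get (g e)).2)
    (fun a e => {pick G (l.get (g e)).1 (x a)}) ?_ ?_ (fun a e => connOn_singleton _)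
    (fun a e => ⟨_, rfl, (hpick a e).2⟩) ?_ ?_ ?_ ?_ ?_ ?_
  · exact fun e => connOn_of_induce_connected (hN.2 _ (hmem e)).1.1.2
  · intro e f hef c hc d hd
    refine ⟨Set.disjoint_left.1 (hdisj e f hef) (Or.inr hc) |> fun h h' => h (h' ▸ Or.inr hd), ?_⟩
    rcases hcase hef with h | h
    · exact fun h' => (hpair _ _ h).2 d (Or.inr hd) c hc h'.symm
    · exact (hpair _ _ h).2 c (Or.inr hc) d hd
  · intro a e
    obtain ⟨y, hy, hadj⟩ := (hN.2 _ (hmem e)).1.1.1.2 _ (hpick a e).1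
    exact ⟨_, rfl, y, hy, hadj⟩
  · rintro a e f hef c rfl d hd
    refine ⟨Set.disjoint_left.1 (hdisj e f hef) (Or.inl (hpick a e).1) |>
      fun h h' => h (h' ▸ Or.inr hd), ?_⟩
    rcases hcase hef with h | h
    · exact fun h' => (hbad' a _ _ h).1 ⟨d, hd, h'⟩
    · exact (hpair _ _ h).2 _ (Or.inl (hpick a e).1) d hd
  · rintro a e c rfl d hd
    exact ⟨Set.disjoint_left.1 (hN.2 _ (hmem e)).2.1.symm (hx a) |>
      fun h h' => h (h' ▸ Or.inr hd), (hN.2 _ (hmem e)).2.2.1 _ (hx a) d hd⟩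
  · rintro a e f hef c rfl d rfl
    refine ⟨Set.disjoint_left.1 (hdisj e f hef) (Or.inl (hpick a e).1) |>
      fun h h' => h (h' ▸ Or.inl (hpick a f).1), ?_⟩
    rcases hcase hef with h | h
    · exact (hbad' a _ _ h).2
    · exact fun h' => (hbad' a _ _ h).2 h'.symm
  · exact fun a e => (hpick a e).2.ne
  · intro a b hab e f c hc d hd
    have key : ∀ a e, ∀ c ∈ (insert (x a) {pick G (l.get (g e)).1 (x a)} : Set V), Near G 1 (x a) c := by
      rintro a e c (rfl | rfl)
      exacts [Near.refl _ _, Near.of_adj (hpick a e).2]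
    have hno : ¬ Near G 1 c d := fun h =>
      hfar a b hab (((key a e c hc).trans h).trans (key b f d hd).symm)
    exact ⟨fun h => hno (h ▸ Near.refl _ _), fun h => hno (Near.of_adj h)⟩

/-- Ramsey twice: first for `Good`, then for adjacency of picks. All picks are neighbours of `u`, so
`τ + 1` pairwise adjacent ones would contradict the colouring of its ball. -/
theorem exists_good_or_bad (τ m N : ℕ) : ∃ r : ℕ, ∀ (V : Type u) (G : SimpleGraph V) (u : V)
    (Z : Set V) (l : List (Set V × Set V)), ColorableOn G {v | Near G 1 u v} τ →
    u ∈ Z → Nested G l Z → r ≤ l.length →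
    (∃ l' : List (Set V × Set V), l'.Sublist l ∧ l'.length = m ∧ l'.Pairwise (Good G u)) ∨
      ∃ l' : List (Set V × Set V), l'.Sublist l ∧ l'.length = N ∧ l'.Pairwise (Bad G u) := by
  obtain ⟨r₁, h₁⟩ := exists_ramsey_list.{u} N (τ + 1)
  obtain ⟨r₂, h₂⟩ := exists_ramsey_list.{u} m r₁
  refine ⟨r₂, fun V G u Z l hτ hu hN hl => ?_⟩
  rcases h₂ (Good G u) l hl with h | ⟨l₁, hs₁, hl₁, hp₁⟩
  · exact Or.inl h
  refine Or.inr ?_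
  rcases h₁ (fun a b => ¬ G.Adj (pick G a.1 u) (pick G b.1 u)) l₁ hl₁.ge with
    ⟨l₂, hs₂, hl₂, hp₂⟩ | ⟨l₂, hs₂, hl₂, hp₂⟩
  · exact ⟨l₂, hs₂.trans hs₁, hl₂, (hp₁.sublist hs₂).and hp₂⟩
  · exfalso
    obtain ⟨f, hf, hp⟩ := hτ
    have hnear : ∀ a ∈ l₂, Near G 1 u (pick G a.1 u) := fun a ha =>
      Near.of_adj (pick_spec ((hN.2 a (hs₁.subset (hs₂.subset ha))).2.2.2.2 u hu)).2
    have hnd : (l₂.map fun a => f (pick G a.1 u)).Nodup := by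
      rw [List.Nodup, List.pairwise_map]
      refine hp₂.imp_of_mem fun {a b} ha hb h => ?_
      exact hp _ (hnear a ha) _ (hnear b hb) (not_not.1 h)
    have hsub : (l₂.map fun a => f (pick G a.1 u)).toFinset ⊆ Finset.range τ := by
      intro k hk
      rw [List.mem_toFinset, List.mem_map] at hk
      obtain ⟨a, ha, rfl⟩ := hk
      exact Finset.mem_range.2 (hf _ (hnear a ha))
    have := Finset.card_le_card hsub
    rw [List.toFinset_card_of_nodup hnd, List.length_map, Finset.card_range, hl₂] at this
    omega

theorem exists_good_system (I : Type*) [Fintype I] [Nonempty I] (ν τ D c m : ℕ) :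
    ∃ c' : ℕ, ∀ (V : Type u) [Finite V] (G : SimpleGraph V) (Z : Set V),
      (∀ v, ColorableOn G {u | Near G (2 * D + 3) v u} τ) →
      SubdivisionFree (subdividedComplete ν) G → ¬ ColorableOn G Z c' →
      HasSystem I G D
        (fun anc Z => ¬ ColorableOn G Z c ∧ ∀ u ∈ Z, anc.Pairwise (Good G u)) m [] Z := by
  classical
  obtain ⟨r, hr⟩ := exists_good_or_bad.{u} τ m (Fintype.card (Sym2 (Fin ν)))
  obtain ⟨c', hc'⟩ := exists_hasSystem.{u} I (Bool × List.Vector Bool r) ν τ D (max c (ν * τ)) r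
  refine ⟨c', fun V _ G Z hτ hfree hZ => ?_⟩
  let Q : List (Set V × Set V) → V → Bool × List.Vector Bool r → Prop := fun anc u k =>
    if k.1 then (select k.2.1 anc).length = m ∧ (select k.2.1 anc).Pairwise (Good G u)
    else (select k.2.1 anc).length = Fintype.card (Sym2 (Fin ν)) ∧
      (select k.2.1 anc).Pairwise (Bad G u)
  -- The colour records which Ramsey outcome holds for `u` and at which levels of the branch. The
  -- default value is never used at a leaf, by `hκ`.
  let κ : List (Set V × Set V) → V → Bool × List.Vector Bool r := fun anc u =>
    if h : ∃ k, Q anc u k then h.choose else (false, List.Vector.replicate r false)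
  have hκ : ∀ anc u Z, anc.length = r → Nested G anc Z → u ∈ Z → Q anc u (κ anc u) := by
    intro anc u Z hl hN hu
    have hex : ∃ k, Q anc u k := by
      rcases hr V G u Z anc ((hτ u).mono (fun v hv => Near.mono hv (by omega)) le_rfl) hu hN
        hl.ge with ⟨l', hs, hl', hp⟩ | ⟨l', hs, hl', hp⟩ <;>
        obtain ⟨mask, hmask, rfl⟩ := exists_select_of_sublist hs
      · exact ⟨(true, ⟨mask, hmask.trans hl⟩), by simp only [Q, if_true]; exact ⟨hl', hp⟩⟩
      · refine ⟨(false, ⟨mask, hmask.trans hl⟩), ?_⟩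
        simp only [Q, Bool.false_eq_true, if_false]
        exact ⟨hl', hp⟩
    simp only [κ]
    rw [dif_pos hex]
    exact hex.choose_spec
  obtain ⟨⟨b, mask⟩, hsys⟩ := hc' V G κ [] Z hτ hfree
    ⟨List.Pairwise.nil, fun a ha => absurd ha List.not_mem_nil⟩ hZ
  obtain ⟨anc, C, hanc, hN, hC, hk⟩ := hsys.exists_leaf
  rw [List.nil_append] at hN hk
  obtain ⟨u₀, hu₀⟩ := nonempty_of_not_colorableOn hC
  cases b with
  | false =>
    exfalso
    have hQ : ∀ u ∈ C, Q anc u (false, mask) := fun u hu => hk u hu ▸ hκ anc u C hanc hN hu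
    simp only [Q, Bool.false_eq_true, if_false] at hQ
    exact not_subdivisionFree_of_bad (fun v => (hτ v).mono
      (fun u hu => Near.mono hu (by omega)) le_rfl) (hN.sublist (select_sublist _ _))
      (hQ u₀ hu₀).1 (fun u hu => (hQ u hu).2)
      (fun h => hC (h.mono subset_rfl (le_max_right _ _))) hfree
  | true =>
    have hQ : Q anc u₀ (true, mask) := hk u₀ hu₀ ▸ hκ anc u₀ C hanc hN hu₀
    simp only [Q, if_true] at hQ
    -- A single leaf vertex suffices to read off the number of levels kept, because the mask is
    -- common to all leaves.
    have hcount : mask.1.count true = m := by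
      rw [← length_select mask.1 anc (mask.2.trans hanc.symm), hQ.1]
    rw [← hcount]
    refine hsys.thin mask.1 mask.2 ?_
    rintro suf C' hs ⟨hN', hC', hk'⟩
    rw [List.nil_append] at hN' hk' ⊢
    refine ⟨fun h => hC' (h.mono subset_rfl (le_max_left _ _)), fun u hu => ?_⟩
    have hQ' : Q suf u (true, mask) :=
      hk' u hu ▸ hκ suf u C' (hs.trans mask.2) hN' hu
    simp only [Q, if_true] at hQ'
    exact hQ'.2

end Picks

/-! ### Systems indexed by words. -/

section Functional

variable {V I : Type*}

/-- The values of `F` at the proper initial segments of a list. -/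
def trace {α : Type*} (F : List I → α) : List I → List α
  | [] => []
  | i :: l => F [] :: trace (fun t => F (i :: t)) l

theorem mem_trace {α : Type*} (F : List I → α) (t : List I) (j : I) (s : List I) :
    F t ∈ trace F (t ++ j :: s) := by
  induction t generalizing F with
  | nil => exact List.mem_cons_self
  | cons i t ih => exact List.mem_cons_of_mem _ (ih fun l => F (i :: l))

theorem rel_of_pairwise_trace {α : Type*} {R : α → α → Prop} (F : List I → α) (p : List I) (i : I)
    (t : List I) (j : I) (s : List I) (h : (trace F (p ++ i :: (t ++ j :: s))).Pairwise R) :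
    R (F p) (F (p ++ i :: t)) := by
  induction p generalizing F with
  | nil => exact (List.pairwise_cons.1 h).1 _ (mem_trace (fun l => F (i :: l)) t j s)
  | cons k p ih => exact ih (fun l => F (k :: l)) (List.pairwise_cons.1 h).2

/-- A system whose pineapples and regions are indexed by the lists over `I`. -/
structure IsSystem (G : SimpleGraph V) (D : ℕ) (P : List (Set V × Set V) → Set V → Prop) (n : ℕ)
    (anc : List (Set V × Set V)) (Z : Set V) (F : List I → Set V × Set V) (A : List I → Set V) :
    Prop where
  root : A [] ⊆ Z
  levelled : ∀ l, l.length < n → IsLevelledPineapple G (F l).1 (F l).2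
  subset : ∀ l, l.length < n → (F l).1 ∪ (F l).2 ⊆ A l
  child : ∀ l i, l.length < n → A (l ++ [i]) ⊆ A l ∧ Disjoint ((F l).1 ∪ (F l).2) (A (l ++ [i])) ∧
    NoEdges G (A (l ++ [i])) (F l).2 ∧ Covers G (F l).1 (A (l ++ [i]))
  far : ∀ l i j, l.length < n → i ≠ j → ∀ a ∈ A (l ++ [i]), ∀ b ∈ A (l ++ [j]), ¬ Near G D a b
  leaf : ∀ l, l.length = n → P (anc ++ trace F l) (A l)

variable {G : SimpleGraph V} {D : ℕ} {P : List (Set V × Set V) → Set V → Prop}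

/-- Unfolding the recursion into functions on words lets the vertices of `T` address nodes directly.
-/
theorem HasSystem.exists_isSystem {n : ℕ} {anc : List (Set V × Set V)} {Z : Set V}
    (h : HasSystem I G D P n anc Z) : ∃ F A, IsSystem (I := I) G D P n anc Z F A := by
  induction n generalizing anc Z with
  | zero =>
    obtain ⟨W, hW, hP⟩ := h
    refine ⟨fun _ => (∅, ∅), fun _ => W, hW, ?_, ?_, ?_, ?_, ?_⟩
    any_goals intros; omega
    intro l hl
    rw [List.length_eq_zero_iff.1 hl]
    simpa [trace] using hP
  | succ n ih =>
    obtain ⟨X, Y, B, h1, h2, h3, h4, h5⟩ := h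
    choose F A hFA using fun i => ih (h5 i)
    refine ⟨fun l => match l with | [] => (X, Y) | i :: l => F i l,
      fun l => match l with | [] => Z | i :: l => A i l, subset_rfl, ?_, ?_, ?_, ?_, ?_⟩
    · rintro (_ | ⟨i, l⟩) hl
      · exact h1
      · exact (hFA i).levelled l (by simpa using hl)
    · rintro (_ | ⟨i, l⟩) hl
      · exact h2
      · exact (hFA i).subset l (by simpa using hl)
    · rintro (_ | ⟨i, l⟩) j hl
      · have hj := (hFA j).root
        obtain ⟨g1, g2, g3, g4⟩ := h3 j
        exact ⟨hj.trans g1, g2.mono_right hj, g3.mono_left hj, g4.mono hj⟩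
      · exact (hFA i).child l j (by simpa using hl)
    · rintro (_ | ⟨i, l⟩) j k hl hjk
      · exact fun a ha b hb => h4 j k hjk a ((hFA j).root ha) b ((hFA k).root hb)
      · exact (hFA i).far l j k (by simpa using hl) hjk
    · rintro (_ | ⟨i, l⟩) hl
      · simp at hl
      · have := (hFA i).leaf l (by simpa using hl)
        rwa [List.append_assoc] at this

namespace IsSystem

variable {n : ℕ} {anc : List (Set V × Set V)} {Z : Set V} {F : List I → Set V × Set V}
  {A : List I → Set V}

theorem append_subset (h : IsSystem G D P n anc Z F A) (l s : List I)
    (hl : (l ++ s).length ≤ n) : A (l ++ s) ⊆ A l := by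
  induction s generalizing l with
  | nil => simp
  | cons i s ih =>
    have hlen : l.length < n := by
      rw [List.length_append, List.length_cons] at hl
      omega
    have := ih (l ++ [i]) (by simpa using hl)
    rw [List.append_assoc, List.singleton_append] at this
    exact this.trans (h.child l i hlen).1

theorem below (h : IsSystem G D P n anc Z F A) (l : List I) (i : I) (s : List I)
    (hl : (l ++ i :: s).length ≤ n) : l.length < n ∧
    Disjoint ((F l).1 ∪ (F l).2) (A (l ++ i :: s)) ∧
    NoEdges G (A (l ++ i :: s)) (F l).2 ∧ Covers G (F l).1 (A (l ++ i :: s)) := by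
  have hlen : l.length < n := by
    rw [List.length_append, List.length_cons] at hl
    omega
  have hsub := h.append_subset (l ++ [i]) s (by simpa using hl)
  rw [List.append_assoc, List.singleton_append] at hsub
  obtain ⟨-, h2, h3, h4⟩ := h.child l i hlen
  exact ⟨hlen, h2.mono_right hsub, h3.mono_left hsub, h4.mono hsub⟩

theorem far_of_not_prefix (h : IsSystem G D P n anc Z F A) {l l' : List I} (hl : l.length ≤ n)
    (hl' : l'.length ≤ n) (h1 : ¬ l <+: l') (h2 : ¬ l' <+: l) :
    ∀ a ∈ A l, ∀ b ∈ A l', ¬ Near G D a b := by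
  -- Two words, neither a prefix of the other, branch apart after their longest common prefix `p`.
  obtain ⟨p, i, j, s, s', hij, rfl, rfl⟩ : ∃ (p : List I) (i j : I) (s s' : List I), i ≠ j ∧
      l = p ++ i :: s ∧ l' = p ++ j :: s' := by
    clear hl hl'
    induction l generalizing l' with
    | nil => exact absurd (List.nil_prefix) h1
    | cons i l ih =>
      cases l' with
      | nil => exact absurd (List.nil_prefix) h2
      | cons j l' =>
        by_cases hij : i = j
        · subst hij
          rw [List.prefix_cons_inj] at h1 h2
          obtain ⟨p, k, k', s, s', hk, rfl, rfl⟩ := ih h1 h2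
          exact ⟨i :: p, k, k', s, s', hk, rfl, rfl⟩
        · exact ⟨[], i, j, l, l', hij, rfl, rfl⟩
  have e : ∀ k (t : List I), (p ++ k :: t).length ≤ n → A (p ++ k :: t) ⊆ A (p ++ [k]) := by
    intro k t ht
    have := h.append_subset (p ++ [k]) t (by simpa using ht)
    rwa [List.append_assoc, List.singleton_append] at this
  intro a ha b hb
  exact h.far p i j (h.below p i s hl).1 hij a (e i s hl ha) b (e j s' hl' hb)

end IsSystem

end Functional

/-! ### Encoding a rooted tree by words over its own vertices. -/

section Addresses

variable {I : Type*} {T : SimpleGraph I}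

/-- The path from the root to `v`. -/
noncomputable def rootPath (hT : T.IsTree) (r v : I) : T.Walk r v :=
  (hT.existsUnique_path r v).choose

theorem isPath_rootPath (hT : T.IsTree) (r : I) (v : I) : (rootPath hT r v).IsPath :=
  (hT.existsUnique_path r v).choose_spec.1

theorem eq_rootPath (hT : T.IsTree) (r : I) {v : I} {p : T.Walk r v} (hp : p.IsPath) : p = rootPath hT r v :=
  (hT.existsUnique_path r v).choose_spec.2 p hp

/-- The vertices of the path from the root to `v`, without the root. -/
noncomputable def address (hT : T.IsTree) (r v : I) : List I :=
  (rootPath hT r v).support.tail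

theorem support_rootPath (hT : T.IsTree) (r : I) (v : I) : (rootPath hT r v).support = r :: address hT r v :=
  (rootPath hT r v).cons_tail_support.symm

theorem isAncestor_iff_mem (hT : T.IsTree) (r : I) {u v : I} :
    IsAncestor T r v u ↔ v ∈ (rootPath hT r u).support := by
  constructor
  · rintro ⟨p, hp, hv⟩
    rw [← eq_rootPath hT r hp.reverse]
    simpa using hv
  · intro h
    exact ⟨(rootPath hT r u).reverse, (isPath_rootPath hT r u).reverse, by simpa using h⟩

theorem isAncestor_iff_prefix (hT : T.IsTree) (r : I) {u v : I} :
    IsAncestor T r v u ↔ address hT r v <+: address hT r u := by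
  classical
  rw [isAncestor_iff_mem hT, ← List.prefix_cons_inj r, ← support_rootPath, ← support_rootPath]
  constructor
  · intro h
    refine ⟨((rootPath hT r u).dropUntil v h).support.tail, ?_⟩
    rw [← eq_rootPath hT r ((isPath_rootPath hT r u).takeUntil h), ← Walk.support_append,
      Walk.take_spec]
  · exact fun h => h.subset (Walk.end_mem_support _)

theorem address_injective (hT : T.IsTree) (r : I) : Function.Injective (address hT r) := by
  intro u v h
  have h' : (rootPath hT r u).support = (rootPath hT r v).support := by
    rw [support_rootPath, support_rootPath, h]
  have h1 := (rootPath hT r u).getLast_support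
  have h2 := (rootPath hT r v).getLast_support
  rw [← h1, ← h2]
  congr 1

theorem length_address_lt (hT : T.IsTree) (r : I) [Fintype I] (v : I) : (address hT r v).length < Fintype.card I := by
  rw [address, List.length_tail, Walk.length_support]
  exact (isPath_rootPath hT r v).length_lt

theorem not_isLeaf_of_isAncestor (hT : T.IsTree) (r : I) {u v : I} (h : IsAncestor T r v u) (huv : u ≠ v) :
    ¬ IsLeaf T r v := by
  classical
  have hv := (isAncestor_iff_mem hT r).1 h
  have hp := isPath_rootPath hT r u
  rw [← (rootPath hT r u).take_spec hv] at hp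
  generalize (rootPath hT r u).takeUntil v hv = q at hp
  generalize (rootPath hT r u).dropUntil v hv = s at hp
  intro hleaf
  cases s with
  | nil => exact huv rfl
  | @cons _ w _ e s =>
    rw [← Walk.concat_append] at hp
    have hq := hp.of_append_left
    exact hleaf w ⟨e.symm, (q.concat e).reverse, hq.reverse, by simp⟩

open Classical in
/-- The address of `v`, extended to length `m` if `v` is a leaf. -/
noncomputable def code (hT : T.IsTree) (r : I) (m : ℕ) (v : I) : List I :=
  if IsLeaf T r v then address hT r v ++ List.replicate (m - (address hT r v).length) r
  else address hT r v

theorem address_prefix_code (hT : T.IsTree) (r : I) (m : ℕ) (v : I) : address hT r v <+: code hT r m v := by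
  unfold code
  split_ifs
  · exact List.prefix_append _ _
  · exact List.prefix_rfl

theorem code_of_not_isLeaf (hT : T.IsTree) (r : I) (m : ℕ) {v : I} (h : ¬ IsLeaf T r v) :
    code hT r m v = address hT r v := by
  rw [code, if_neg h]

theorem length_code_of_isLeaf (hT : T.IsTree) (r : I) [Fintype I] {v : I} (h : IsLeaf T r v) :
    (code hT r (Fintype.card I) v).length = Fintype.card I := by
  have := length_address_lt hT r v
  rw [code, if_pos h, List.length_append, List.length_replicate]
  omega

theorem length_code_of_not_isLeaf (hT : T.IsTree) (r : I) [Fintype I] {v : I} (h : ¬ IsLeaf T r v) :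
    (code hT r (Fintype.card I) v).length < Fintype.card I := by
  rw [code_of_not_isLeaf hT r _ h]
  exact length_address_lt hT r v

theorem length_code_le (hT : T.IsTree) (r : I) [Fintype I] (v : I) :
    (code hT r (Fintype.card I) v).length ≤ Fintype.card I := by
  by_cases h : IsLeaf T r v
  · exact (length_code_of_isLeaf hT r h).le
  · exact (length_code_of_not_isLeaf hT r h).le

/-- A proper ancestor is not a leaf, so its code carries no padding and is a proper prefix. -/
theorem exists_code_eq_append (hT : T.IsTree) (r : I) (m : ℕ) {u v : I} (h : IsAncestor T r v u) (huv : u ≠ v) :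
    ∃ i s, code hT r m u = code hT r m v ++ i :: s := by
  rw [code_of_not_isLeaf hT r m (not_isLeaf_of_isAncestor hT r h huv)]
  obtain ⟨t, ht⟩ := (isAncestor_iff_prefix hT r).1 h
  obtain ⟨s, hs⟩ := address_prefix_code hT r m u
  cases t with
  | nil =>
    rw [List.append_nil] at ht
    exact absurd (address_injective hT r ht).symm huv
  | cons i t => exact ⟨i, t ++ s, by rw [← hs, ← ht]; simp⟩

/-- Padding creates no new comparabilities: both addresses would be prefixes of the same word, hence
comparable. -/
theorem not_code_prefix_code (hT : T.IsTree) (r : I) (m : ℕ) {u v : I} (h : Incomparable T r u v) :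
    ¬ code hT r m u <+: code hT r m v := by
  intro hp
  rcases List.prefix_or_prefix_of_prefix ((address_prefix_code hT r m u).trans hp)
    (address_prefix_code hT r m v) with h' | h'
  · exact h.1 ((isAncestor_iff_prefix hT r).2 h')
  · exact h.2 ((isAncestor_iff_prefix hT r).2 h')

end Addresses

/-! ### The fruitful pineapple tree inside a good system. -/

section Trees

variable {V I : Type*} {G : SimpleGraph V} {T : SimpleGraph I}

theorem Incomparable.symm {r u v : I} (h : Incomparable T r u v) : Incomparable T r v u :=
  ⟨h.2, h.1⟩

theorem incomparable_of_isLeaf (hT : T.IsTree) {r u v : I} (hu : IsLeaf T r u) (hv : IsLeaf T r v)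
    (huv : u ≠ v) : Incomparable T r u v :=
  ⟨fun h => not_isLeaf_of_isAncestor hT r h huv.symm hu,
    fun h => not_isLeaf_of_isAncestor hT r h huv hv⟩

open Classical in
/-- A system of depth `|I|` contains a fruitful pineapple tree of every shape on `I`. -/
theorem IsSystem.exists_pineappleTree [Fintype I] (hT : T.IsTree) (r : I) {D c : ℕ} (hD : 2 ≤ D)
    {Z : Set V} {F : List I → Set V × Set V} {A : List I → Set V}
    (h : IsSystem G D (fun anc Z => ¬ ColorableOn G Z c ∧ ∀ u ∈ Z, anc.Pairwise (Good G u))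
      (Fintype.card I) [] Z F A) :
    ∃ P : PineappleTree G T r, P.Fruitful ∧ P.vertexSet ⊆ Z ∧
      (∀ v, IsLeaf T r v → ¬ ColorableOn G (P.C v) c) ∧
      ∀ u v, IsLeaf T r u → IsLeaf T r v → Incomparable T r u v →
        ∀ a ∈ P.C u, ∀ b ∈ P.C v, ¬ Near G D a b := by
  let φ : I → List I := code hT r (Fintype.card I)
  -- Only picks made by leaf vertices below `v` are kept. They still cover the leaf regions, and
  -- goodness is known for no other vertices of the original `X`-part.
  let X : I → Set V := fun v =>
    {x | x ∈ (F (φ v)).1 ∧ ∃ u, IsLeaf T r u ∧ IsAncestor T r v u ∧ u ≠ v ∧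
      ∃ c ∈ A (φ u), x = pick G (F (φ v)).1 c}
  let C : I → Set V := fun v => if IsLeaf T r v then A (φ v) else X v ∪ (F (φ v)).2
  have hX : ∀ v, X v ⊆ (F (φ v)).1 := fun v x hx => hx.1
  have hCleaf : ∀ {v}, IsLeaf T r v → C v = A (φ v) := fun hv => if_pos hv
  have hCnode : ∀ {v}, ¬ IsLeaf T r v → C v = X v ∪ (F (φ v)).2 := fun hv => if_neg hv
  have hlen : ∀ v, (φ v).length ≤ Fintype.card I := length_code_le hT r
  have hCA : ∀ v, C v ⊆ A (φ v) := by
    intro v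
    by_cases hv : IsLeaf T r v
    · rw [hCleaf hv]
    · rw [hCnode hv]
      exact (Set.union_subset_union_left _ (hX v)).trans
        (h.subset _ (length_code_of_not_isLeaf hT r hv))
  have hbelow : ∀ {u v}, u ≠ v → IsAncestor T r v u → ¬ IsLeaf T r v ∧
      Disjoint ((F (φ v)).1 ∪ (F (φ v)).2) (A (φ u)) ∧
      NoEdges G (A (φ u)) (F (φ v)).2 ∧ Covers G (F (φ v)).1 (A (φ u)) := by
    intro u v huv hanc
    obtain ⟨i, s, hs⟩ := exists_code_eq_append hT r (Fintype.card I) hanc huv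
    have := h.below (φ v) i s (hs ▸ hlen u)
    rw [← show φ u = φ v ++ i :: s from hs] at this
    exact ⟨not_isLeaf_of_isAncestor hT r hanc huv, this.2⟩
  have hfar : ∀ {u v}, Incomparable T r u v → ∀ a ∈ A (φ u), ∀ b ∈ A (φ v), ¬ Near G D a b :=
    fun huv => h.far_of_not_prefix (hlen _) (hlen _) (not_code_prefix_code hT r _ huv)
      (not_code_prefix_code hT r _ huv.symm)
  have hdisj : ∀ {u v}, u ≠ v → IsAncestor T r v u → Disjoint (C v) (C u) := by
    intro u v huv hanc
    obtain ⟨h1, h2, -⟩ := hbelow huv hanc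
    rw [hCnode h1]
    exact h2.mono (Set.union_subset_union_left _ (hX v)) (hCA u)
  have hpick : ∀ {u v}, u ≠ v → IsAncestor T r v u → ∀ c ∈ A (φ u),
      pick G (F (φ v)).1 c ∈ (F (φ v)).1 ∧ G.Adj c (pick G (F (φ v)).1 c) :=
    fun huv hanc c hc => pick_spec ((hbelow huv hanc).2.2.2.2 c hc)
  have hleaf : ∀ {v}, IsLeaf T r v → ¬ ColorableOn G (A (φ v)) c ∧
      ∀ u ∈ A (φ v), (trace F (φ v)).Pairwise (Good G u) :=
    fun hv => h.leaf _ (length_code_of_isLeaf hT r hv)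
  refine ⟨⟨X, fun v => (F (φ v)).2, C, ?_, fun v hv => hCnode hv, ?_, ?_, ?_, ?_, ?_⟩,
    ?_, ?_, ?_, ?_⟩
  · exact fun v hv => (h.levelled _ (length_code_of_not_isLeaf hT r hv)).mono (hX v)
  · intro v
    by_cases hv : IsLeaf T r v
    · rw [hCleaf hv]
      exact nonempty_of_not_colorableOn (hleaf hv).1
    · rw [hCnode hv]
      obtain ⟨-, z, hz, -⟩ := h.levelled _ (length_code_of_not_isLeaf hT r hv)
      exact ⟨z, Or.inr hz⟩
  · intro u v huv
    by_cases h1 : IsAncestor T r v u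
    · exact (hdisj huv h1).symm
    by_cases h2 : IsAncestor T r u v
    · exact hdisj huv.symm h2
    · rw [Set.disjoint_left]
      exact fun x hx hx' => hfar ⟨h2, h1⟩ x (hCA u hx) x (hCA v hx') (Near.refl _ _)
  · exact fun u v huv a ha b hb hadj =>
      hfar huv a (hCA u ha) b (hCA v hb) ((Near.of_adj hadj).mono (by omega))
  · exact fun u v huv hanc => (hbelow huv hanc).2.2.1.mono_left (hCA u)
  · intro u v huv hanc hu
    rw [hCleaf hu]
    refine ⟨(hbelow huv hanc).2.2.2.1.mono_right (hX v), fun x hx => ?_⟩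
    obtain ⟨h1, h2⟩ := hpick huv hanc x hx
    exact ⟨_, ⟨h1, u, hu, hanc, huv, x, hx, rfl⟩, h2⟩
  · rintro u v w ⟨hu, hwu, hvw, huv, huw, hvw'⟩ x ⟨⟨-, u', hu', hvu', huv', c', hc', rfl⟩, a, ha,
      hxa⟩
    replace ha : a ∈ A (φ u) := hCA u ha
    -- The vertex `x` is adjacent to `c'` in the region of `u'` and to `a` in that of `u`. Regions
    -- of different leaves are more than `D ≥ 2` apart, so `c'` lies below `u`, and its goodness
    -- gives the required neighbour of `x`.
    have huu' : u' = u := by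
      by_contra hne
      refine hfar (incomparable_of_isLeaf hT hu' hu hne) c' hc' a ha ?_
      exact ((Near.of_adj (hpick huv' hvu' c' hc').2).trans (Near.of_adj hxa)).mono hD
    subst huu'
    obtain ⟨i, t, ht⟩ := exists_code_eq_append hT r (Fintype.card I) hvw hvw'.symm
    obtain ⟨j, s, hs⟩ := exists_code_eq_append hT r (Fintype.card I) hwu huw
    have hgood := (hleaf hu).2 c' hc'
    rw [show φ u' = _ from hs, ht, List.append_assoc, List.cons_append] at hgood
    have := rel_of_pairwise_trace F _ i t j s hgood
    rw [← ht] at this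
    exact this
  · refine Set.iUnion_subset fun v => (hCA v).trans ?_
    exact (h.append_subset [] (φ v) (by simpa using hlen v)).trans h.root
  · intro v hv
    show ¬ ColorableOn G (C v) c
    rw [hCleaf hv]
    exact (hleaf hv).1
  · exact fun u v _ _ huv a ha b hb => hfar huv a (hCA u ha) b (hCA v hb)

end Trees

end InducedSubgraphs

theorem theorem5p4 (ν c d τ : ℕ) {I : Type*} [Finite I] (T : SimpleGraph I) (hT : T.IsTree)
    (r : I) :
    ∃ c' : ℕ, ∀ (V : Type*) [Finite V] (G : SimpleGraph V) (Z : Set V),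
      InducedSubgraphs.SubdivisionFree (InducedSubgraphs.subdividedComplete ν) G →
      InducedSubgraphs.chiBall G (2 * d + 7) ≤ (τ : ℕ∞) →
      (c' : ℕ∞) < InducedSubgraphs.chi G Z →
      ∃ P : InducedSubgraphs.PineappleTree G T r,
        P.Fruitful ∧
        P.vertexSet ⊆ Z ∧
        (∀ v, InducedSubgraphs.IsLeaf T r v → (c : ℕ∞) < InducedSubgraphs.chi G (P.C v)) ∧
        ∀ u v, InducedSubgraphs.IsLeaf T r u → InducedSubgraphs.IsLeaf T r v →
          InducedSubgraphs.Incomparable T r u v →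
          ((d + 1 : ℕ) : ℕ∞) ≤ InducedSubgraphs.setDist G (P.C u) (P.C v) := by
  have := Fintype.ofFinite I
  have : Nonempty I := ⟨r⟩
  -- With separation `D = d + 2` the radius `2 * D + 3` equals `2 * d + 7`, and `D ≥ 2` as
  -- fruitfulness needs. Addresses are shorter than `|I|`, so depth `|I|` leaves room for every
  -- vertex of `T`.
  obtain ⟨c', hc'⟩ := InducedSubgraphs.exists_good_system I ν τ (d + 2) c (Fintype.card I)
  refine ⟨c', fun V _ G Z hfree hball hZ => ?_⟩
  obtain ⟨F, A, hFA⟩ := (hc' V G Z (InducedSubgraphs.colorableOn_near_of_chiBall hball) hfree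
    (InducedSubgraphs.lt_chi_iff.1 hZ)).exists_isSystem
  obtain ⟨P, h1, h2, h3, h4⟩ := hFA.exists_pineappleTree hT r (by omega)
  refine ⟨P, h1, h2, fun v hv => InducedSubgraphs.lt_chi_iff.2 (h3 v hv), fun u v hu hv huv => ?_⟩
  refine le_iInf fun a => le_iInf fun ha => le_iInf fun b => le_iInf fun hb => ?_
  by_contra hlt
  exact h4 u v hu hv huv a ha b hb ((InducedSubgraphs.edist_le_iff_near.1 (not_le.1 hlt).le).mono (by omega))
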